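/- Let $\mathbb{k}$ be a field, $n \ge 0$, and $R = \mathbb{k}[x_1,\dots,x_n]$. Let $\mathcal{I} = \{I_k\}_{k \ge 0}$ be a graded family of monomial ideals of $R$, that is, each $I_k$ is generated by monomials, $I_0 = R$, and $I_p I_q \subseteq I_{p+q}$ for all $p, q \ge 0$. For an ideal $I$, let $\overline{I}$ denote its integral closure, i.e. the ideal of all $x \in R$ that satisfy an equation $x^d + a_1 x^{d-1} + \dots + a_d = 0$ with $d \ge 1$ and $a_i \in I^i$ for all $i$; then $\overline{\mathcal{I}} = \{\overline{I_k}\}_{k \ge 0}$ is again a graded family. The Rees algebra of a graded family $\{J_k\}_{k\ge 0}$ is $\mathcal{R}(\{J_k\}) = \bigoplus_{k \ge 0} J_k t^k \subseteq R[t]$. The Newton polyhedron of a monomial ideal $I$ is $\mathrm{NP}(I) = \mathrm{conv}\{\mathbf{a} \in \mathbb{N}^n \mid x^{\mathbf{a}} \in I\} \subseteq \mathbb{R}^n$ (so $\mathrm{NP}(0)=\emptyset$). The Newton–Okounkov body and the limiting body of $\mathcal{I}$ are $$\Delta(\mathcal{I}) = \overline{\bigcup_{k \ge 1} \left\{\tfrac{\mathbf{a}}{k}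 \;\middle|\; x^{\mathbf{a}} \in I_k\right\}} \quad\text{(topological closure in } \mathbb{R}^n\text{)}, \qquad \mathcal{C}(\mathcal{I}) = \bigcup_{k \ge 1} \tfrac{1}{k}\mathrm{NP}(I_k).$$ A polyhedron in $\mathbb{R}^n$ is the solution set $\{v \mid Av \le b\}$ of a finite system of real linear inequalities (in particular $\emptyset$ and $\mathbb{R}^n$ are polyhedra). Then the following conditions are equivalent: 1. $\mathcal{C}(\mathcal{I})$ is a polyhedron. 2. There exists an integer $c \ge 1$ such that $\Delta(\mathcal{I}) = \frac{1}{c}\mathrm{NP}(I_c)$. 3. There exists an integer $c \ge 1$ such that $\frac{1}{c}\mathrm{NP}(I_c) = \frac{1}{kc}\mathrm{NP}(I_{kc})$ for all integers $k \ge 1$. 4. There exists an integer $c \ge 1$ such that $\overline{I_c^k} = \overline{I_{kc}}$ for all integers $k \ge 0$. 5. The ring $\mathcal{R}(\overline{\mathcal{I}})$ is Noetherian. 6. The ring $\mathcal{R}(\mathcal{I})$ is Noetherian. -/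

import Mathlib

open scoped Pointwise

namespace MonomialFamily

/-! ### Integral closure of an ideal -/

section IntegralClosure

variable {R : Type*} [CommRing R]

/-- `x` is integral over the ideal `I`: it satisfies an equation
`x ^ d + a₁ * x ^ (d - 1) + ⋯ + a_d = 0` with `aᵢ ∈ I ^ i` for all `i`. -/
def IsIntegralOverIdeal (I : Ideal R) (x : R) : Prop :=
  ∃ p : Polynomial R, p.Monic ∧ (∀ i, p.coeff i ∈ I ^ (p.natDegree - i)) ∧ p.eval x = 0

theorem IsIntegralOverIdeal.of_subsingleton [Subsingleton R] (I : Ideal R) (x : R) :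
    IsIntegralOverIdeal I x :=
  ⟨1, Polynomial.monic_one,
    fun _ => Subsingleton.elim (0 : R) (Polynomial.coeff _ _) ▸ zero_mem _, Subsingleton.elim _ _⟩

/-- The bigraded algebra `⨁ I ^ i * J ^ j * X ^ i * Y ^ j` inside `R[X][Y]`. It is used only to
prove closure properties of integrality over ideals. -/
def biRees (I J : Ideal R) : Subring (Polynomial (Polynomial R)) where
  carrier := {f | ∀ j i, (f.coeff j).coeff i ∈ I ^ i * J ^ j}
  mul_mem' {f g} hf hg j i := by
    rw [Polynomial.coeff_mul, Polynomial.finsetSum_coeff]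
    refine Ideal.sum_mem _ fun a ha => ?_
    rw [Polynomial.coeff_mul]
    refine Ideal.sum_mem _ fun b hb => ?_
    rw [← Finset.HasAntidiagonal.mem_antidiagonal.mp ha, ← Finset.HasAntidiagonal.mem_antidiagonal.mp hb, pow_add, pow_add,
      mul_mul_mul_comm]
    exact Ideal.mul_mem_mul (hf _ _) (hg _ _)
  one_mem' j i := by
    rw [Polynomial.coeff_one]
    split_ifs with h
    · subst h
      rw [Polynomial.coeff_one]
      split_ifs with h
      · subst h
        simp
      · simp
    · simp
  add_mem' hf hg j i := by
    rw [Polynomial.coeff_add, Polynomial.coeff_add]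
    exact Ideal.add_mem _ (hf j i) (hg j i)
  zero_mem' _ _ := by simp
  neg_mem' hf j i := by
    rw [Polynomial.coeff_neg, Polynomial.coeff_neg]
    exact (Ideal.neg_mem_iff _).mpr (hf j i)

theorem monomial_mem_biRees {I J : Ideal R} {i j : ℕ} {r : R} (hr : r ∈ I ^ i * J ^ j) :
    Polynomial.monomial j (Polynomial.monomial i r) ∈ biRees I J := by
  intro b a
  rw [Polynomial.coeff_monomial]
  split_ifs with h
  · subst h
    rw [Polynomial.coeff_monomial]
    split_ifs with h
    · subst h
      exact hr
    · simp
  · simp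

theorem isIntegral_biRees {I J K : Ideal R} {x : R} {a b : ℕ}
    (hK : ∀ k, K ^ k ≤ I ^ (a * k) * J ^ (b * k)) (hx : IsIntegralOverIdeal K x) :
    IsIntegral (biRees I J) (Polynomial.monomial b (Polynomial.monomial a x)) := by
  obtain ⟨p, hp, hc, h0⟩ := hx
  let φ : R →+* Polynomial (Polynomial R) := Polynomial.C.comp Polynomial.C
  let u : Polynomial (Polynomial R) := Polynomial.monomial b (Polynomial.monomial a 1)
  have hu : Polynomial.monomial b (Polynomial.monomial a x) = u * φ x := by
    simp [u, φ, Polynomial.monomial_mul_C]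
  let q := (p.map φ).scaleRoots u
  have hq : q.Monic := (Polynomial.monic_scaleRoots_iff u).mpr (hp.map φ)
  have hqT : (↑q.coeffs : Set (Polynomial (Polynomial R))) ⊆ biRees I J := by
    intro c hcq
    obtain ⟨i, -, rfl⟩ := Polynomial.mem_coeffs_iff.mp hcq
    have hd : (p.map φ).natDegree ≤ p.natDegree := Polynomial.natDegree_map_le
    by_cases hi : p.natDegree < i
    · have : q.coeff i = 0 := by
        rw [Polynomial.coeff_scaleRoots, Polynomial.coeff_map,
          Polynomial.coeff_eq_zero_of_natDegree_lt hi]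
        simp
      rw [this]
      exact (biRees I J).zero_mem
    · have hd' : (p.map φ).natDegree = p.natDegree := by
        nontriviality R
        exact hp.natDegree_map φ
      rw [Polynomial.coeff_scaleRoots, Polynomial.coeff_map, hd']
      have : φ (p.coeff i) * u ^ (p.natDegree - i) =
          Polynomial.monomial (b * (p.natDegree - i))
            (Polynomial.monomial (a * (p.natDegree - i)) (p.coeff i)) := by
        simp [u, φ, Polynomial.monomial_pow, Polynomial.C_mul_monomial]
      rw [this]
      exact monomial_mem_biRees (hK _ (hc i))
  refine ⟨q.toSubring _ hqT, (Polynomial.monic_toSubring _ _ _).mpr hq, ?_⟩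
  have : (Polynomial.eval₂ (algebraMap (biRees I J) (Polynomial (Polynomial R))) (u * φ x)
      (q.toSubring _ hqT)) = Polynomial.eval (u * φ x) q := by
    conv_rhs => rw [← Polynomial.map_toSubring q _ hqT]
    rw [Polynomial.eval_map]
    rfl
  rw [hu, this, Polynomial.scaleRoots_eval_mul, Polynomial.eval_map, Polynomial.eval₂_at_apply, h0,
    map_zero, mul_zero]

theorem isIntegralOverIdeal_of_biRees {I J : Ideal R} {x : R}
    (hx : IsIntegral (biRees I J) (Polynomial.monomial 1 (Polynomial.monomial 1 x))) :
    IsIntegralOverIdeal (I * J) x := by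
  rcases subsingleton_or_nontrivial R with hR | hR
  · exact .of_subsingleton _ _
  obtain ⟨p, hp, e⟩ := hx
  let q : Polynomial R := ∑ i ∈ Finset.range (p.natDegree + 1),
    Polynomial.C (((p.coeff i).1.coeff (p.natDegree - i)).coeff (p.natDegree - i)) *
      Polynomial.X ^ i
  have hqc : ∀ i, q.coeff i = if i < p.natDegree + 1 then
      ((p.coeff i).1.coeff (p.natDegree - i)).coeff (p.natDegree - i) else 0 := by
    intro i
    simp [q, Polynomial.coeff_X_pow]
  have hq1 : q.coeff p.natDegree = 1 := by
    rw [hqc]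
    simp [hp]
  have hq : q.natDegree = p.natDegree := by
    refine Polynomial.natDegree_eq_of_le_of_coeff_ne_zero ?_ (by rw [hq1]; exact one_ne_zero)
    refine Polynomial.natDegree_le_iff_coeff_eq_zero.mpr fun N hN => ?_
    rw [hqc, if_neg (by omega)]
  refine ⟨q, ?_, ?_, ?_⟩
  · rw [Polynomial.Monic, Polynomial.leadingCoeff, hq, hq1]
  · intro i
    rw [hq, hqc]
    split_ifs
    · rw [mul_pow]
      exact (p.coeff i).2 _ _
    · exact zero_mem _
  · replace e := congr((($e).coeff p.natDegree).coeff p.natDegree)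
    rw [Polynomial.eval₂_eq_sum_range, Polynomial.finsetSum_coeff, Polynomial.finsetSum_coeff] at e
    simp only [q, Polynomial.eval_finsetSum, Polynomial.eval_mul, Polynomial.eval_C,
      Polynomial.eval_pow, Polynomial.eval_X]
    refine (Finset.sum_congr rfl fun i hi => ?_).trans (e.trans (by simp))
    have hi' : i ≤ p.natDegree := by
      have := Finset.mem_range.mp hi
      omega
    rw [Polynomial.monomial_pow, Polynomial.monomial_pow, one_mul]
    obtain ⟨d, hd⟩ := Nat.exists_eq_add_of_le' hi'
    rw [hd, Nat.add_sub_cancel, Polynomial.coeff_mul_monomial, Polynomial.coeff_mul_monomial]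
    rfl

theorem IsIntegralOverIdeal.mul {I J : Ideal R} {x y : R} (hx : IsIntegralOverIdeal I x)
    (hy : IsIntegralOverIdeal J y) : IsIntegralOverIdeal (I * J) (x * y) := by
  have h1 := isIntegral_biRees (I := I) (J := J) (a := 1) (b := 0) (by simp) hx
  have h2 := isIntegral_biRees (I := I) (J := J) (a := 0) (b := 1) (by simp) hy
  refine isIntegralOverIdeal_of_biRees ?_
  simpa [Polynomial.monomial_mul_monomial] using h1.mul h2

theorem IsIntegralOverIdeal.add {I : Ideal R} {x y : R} (hx : IsIntegralOverIdeal I x)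
    (hy : IsIntegralOverIdeal I y) : IsIntegralOverIdeal I (x + y) := by
  have h1 := isIntegral_biRees (I := I) (J := ⊤) (a := 1) (b := 1)
    (by simp [Ideal.top_pow]) hx
  have h2 := isIntegral_biRees (I := I) (J := ⊤) (a := 1) (b := 1)
    (by simp [Ideal.top_pow]) hy
  have h := isIntegralOverIdeal_of_biRees (I := I) (J := ⊤) (x := x + y)
    (by simpa using h1.add h2)
  rwa [Ideal.mul_top] at h

theorem IsIntegralOverIdeal.of_mem {I : Ideal R} {x : R} (hx : x ∈ I) :
    IsIntegralOverIdeal I x := by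
  rcases subsingleton_or_nontrivial R with hR | hR
  · exact .of_subsingleton _ _
  refine ⟨Polynomial.X - Polynomial.C x, Polynomial.monic_X_sub_C x, fun i => ?_, by simp⟩
  rw [Polynomial.natDegree_X_sub_C]
  match i with
  | 0 => simpa using hx
  | i + 1 => simp

theorem IsIntegralOverIdeal.mono {I J : Ideal R} (h : I ≤ J) {x : R}
    (hx : IsIntegralOverIdeal I x) : IsIntegralOverIdeal J x := by
  obtain ⟨p, hp, hc, h0⟩ := hx
  exact ⟨p, hp, fun i => Ideal.pow_right_mono h _ (hc i), h0⟩

/-- The integral closure of an ideal `I`: the ideal of all elements that are integral over `I`. -/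
def idealClosure (I : Ideal R) : Ideal R where
  carrier := {x | IsIntegralOverIdeal I x}
  add_mem' hx hy := hx.add hy
  zero_mem' := .of_mem I.zero_mem
  smul_mem' c x hx := by
    have h := (IsIntegralOverIdeal.of_mem (I := ⊤) (x := c) trivial).mul hx
    rwa [Ideal.top_mul] at h

end IntegralClosure

/-! ### Graded families of ideals and their Rees algebras -/

/-- A graded family of ideals `(I_k)` of `R`: `I_p * I_q ⊆ I_{p + q}` for all `p` and `q`, where,
as usual, `I_0 = R` (so that `⨁ I_k * t ^ k` is an `R`-subalgebra of `R[t]`). -/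
structure GradedFamily (R : Type*) [CommRing R] where
  /-- The members of the family. -/
  ideal : ℕ → Ideal R
  ideal_zero : ideal 0 = ⊤
  mul_le : ∀ p q, ideal p * ideal q ≤ ideal (p + q)

namespace GradedFamily

variable {R : Type*} [CommRing R]

/-- The Rees algebra `⨁_{k ≥ 0} I_k * t ^ k ⊆ R[t]` of a graded family. -/
def reesAlgebra (F : GradedFamily R) : Subalgebra R (Polynomial R) where
  carrier := {f | ∀ k, f.coeff k ∈ F.ideal k}
  mul_mem' {f g} hf hg k := by
    rw [Polynomial.coeff_mul]
    refine Ideal.sum_mem _ fun a ha => ?_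
    rw [← Finset.HasAntidiagonal.mem_antidiagonal.mp ha]
    exact F.mul_le _ _ (Ideal.mul_mem_mul (hf _) (hg _))
  add_mem' hf hg k := by
    rw [Polynomial.coeff_add]
    exact Ideal.add_mem _ (hf k) (hg k)
  algebraMap_mem' r k := by
    rw [Polynomial.algebraMap_apply, Polynomial.coeff_C]
    split_ifs with h
    · subst h
      simp [F.ideal_zero]
    · exact zero_mem _

/-- The family of the integral closures of the members of a graded family. -/
def closure (F : GradedFamily R) : GradedFamily R where
  ideal k := idealClosure (F.ideal k)
  ideal_zero := by
    refine (Ideal.eq_top_iff_one _).mpr (IsIntegralOverIdeal.of_mem ?_)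
    rw [F.ideal_zero]
    trivial
  mul_le p q := Ideal.mul_le.mpr fun _ hx _ hy =>
    (IsIntegralOverIdeal.mul hx hy).mono (F.mul_le p q)

end GradedFamily

/-! ### Monomial ideals and the associated convex bodies -/

section Monomial

variable {n : ℕ} {𝕜 : Type*} [Field 𝕜]

/-- A monomial ideal: an ideal generated by a set of monomials. -/
def IsMonomialIdeal (I : Ideal (MvPolynomial (Fin n) 𝕜)) : Prop :=
  ∃ S : Set (Fin n →₀ ℕ), I = Ideal.span ((fun a => MvPolynomial.monomial a (1 : 𝕜)) '' S)

/-- The exponent vectors, as points of `ℝⁿ`, of the monomials in an ideal. -/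
def exponents (I : Ideal (MvPolynomial (Fin n) 𝕜)) : Set (Fin n → ℝ) :=
  {v | ∃ a : Fin n →₀ ℕ, MvPolynomial.monomial a (1 : 𝕜) ∈ I ∧ v = fun i => (a i : ℝ)}

/-- The Newton polyhedron of an ideal: the convex hull of the exponents of its monomials. -/
def newtonPolyhedron (I : Ideal (MvPolynomial (Fin n) 𝕜)) : Set (Fin n → ℝ) :=
  convexHull ℝ (exponents I)

/-- The Newton-Okounkov body of a family: the closure of the set of all points `a / k` with
`k ≥ 1` and `x ^ a ∈ I_k`. -/
def newtonOkounkovBody (F : GradedFamily (MvPolynomial (Fin n) 𝕜)) : Set (Fin n → ℝ) :=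
  _root_.closure (⋃ (k : ℕ) (_ : 0 < k), (1 / (k : ℝ)) • exponents (F.ideal k))

/-- The limiting body of a family: the union over `k ≥ 1` of the sets `(1 / k) • NP(I_k)`. -/
def limitingBody (F : GradedFamily (MvPolynomial (Fin n) 𝕜)) : Set (Fin n → ℝ) :=
  ⋃ (k : ℕ) (_ : 0 < k), (1 / (k : ℝ)) • newtonPolyhedron (F.ideal k)

/-- A polyhedron in `ℝⁿ`: the solution set of a finite system of linear inequalities with real
coefficients, that is, a finite intersection of closed half spaces. -/
def IsPolyhedron (P : Set (Fin n → ℝ)) : Prop :=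
  ∃ (m : ℕ) (A : Matrix (Fin m) (Fin n) ℝ) (b : Fin m → ℝ), P = {x | ∀ j, A.mulVec x j ≤ b j}

end Monomial

end MonomialFamily

/-! Everything is compared with stability, `IsStableAt`: some scaled polyhedron NP(I_c)/c contains
all the NP(I_k)/k. Since I_k^m ⊆ I_{mk}, these sets grow along divisibility of k, so any finite set
of points of their union is captured at a common multiple of the indices
(`smul_newtonPolyhedron_subset_of_dvd`).

If the limiting body is a polyhedron, it lies in the orthant, hence has finitely many vertices and
each of its points dominates a convex combination of them. Capturing the vertices suffices because
Newton polyhedra are closed upwards (`exists_isStableAt_of_isPolyhedron`). Conversely NP(I_c) is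
itself a polyhedron, by Fourier-Motzkin elimination. It is therefore closed, and the Newton-Okounkov
body is closed and convex, so stability is also the statement about Δ.

Integral closures enter because the monomials of the closure of I are the lattice points of NP(I):
one inclusion uses monomial valuations, the other rational convex combinations.

A Noetherian Rees algebra has finitely many monomial generators in positive degree, and the product
of their degrees is a stable index (`exists_isStableAt_of_isNoetherianRing`). Conversely, at a
stable c, rounding convex coefficients down places the Rees algebra inside a finite module over the
finitely generated algebra R[I_c t^c] (`isNoetherianRing_reesAlgebra`). Both arguments apply to the
family and to its closure, whose Newton polyhedra agree. -/

namespace MonomialFamily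

/-! ### Cones and polyhedra -/

section Polyhedra

/-- Fourier-Motzkin elimination: adding a ray to a cone given by finitely many inequalities. -/
theorem exists_finset_dual_add_ray {V : Type*} [AddCommGroup V] [Module ℝ V]
    (s : Finset (Module.Dual ℝ V)) (g : V) :
    ∃ s' : Finset (Module.Dual ℝ V), ∀ x, (∀ φ ∈ s', φ x ≤ 0) ↔
      ∃ t : ℝ, 0 ≤ t ∧ ∀ φ ∈ s, φ (x - t • g) ≤ 0 := by
  classical
  -- The combination `φ g • ψ - ψ g • φ` vanishes at `g`, so it does not see the unknown multiple of
  -- `g`.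
  refine ⟨s.filter (fun φ => φ g ≤ 0) ∪
    ((s ×ˢ s).filter (fun p => 0 < p.1 g ∧ p.2 g < 0)).image
      (fun p => p.1 g • p.2 - p.2 g • p.1), fun x => ⟨fun h => ?_, ?_⟩⟩
  · have h1 : ∀ φ ∈ s, φ g ≤ 0 → φ x ≤ 0 := fun φ hφ hg =>
      h φ (Finset.mem_union_left _ (Finset.mem_filter.mpr ⟨hφ, hg⟩))
    have h2 : ∀ φ ∈ s, ∀ ψ ∈ s, 0 < φ g → ψ g < 0 → φ g * ψ x - ψ g * φ x ≤ 0 := by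
      intro φ hφ ψ hψ hg hg'
      simpa using h (φ g • ψ - ψ g • φ) (Finset.mem_union_right _ (Finset.mem_image.mpr
        ⟨(φ, ψ), Finset.mem_filter.mpr ⟨Finset.mk_mem_product hφ hψ, hg, hg'⟩, rfl⟩))
    -- The functionals with `φ g > 0` are lower bounds for `t`, and so is `0`; the smallest
    -- admissible `t` is taken.
    obtain ⟨t, ht, hmax⟩ := Finset.exists_max_image
      (insert 0 ((s.filter (fun φ => 0 < φ g)).image (fun φ => φ x / φ g))) id
      (Finset.insert_nonempty _ _)
    have hmax' : ∀ φ ∈ s, 0 < φ g → φ x / φ g ≤ t := fun φ hφ hg =>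
      hmax _ (Finset.mem_insert_of_mem (Finset.mem_image.mpr
        ⟨φ, Finset.mem_filter.mpr ⟨hφ, hg⟩, rfl⟩))
    refine ⟨t, hmax 0 (Finset.mem_insert_self _ _), fun φ hφ => ?_⟩
    rw [map_sub, map_smul, smul_eq_mul]
    rcases lt_trichotomy (φ g) 0 with hg | hg | hg
    · rcases Finset.mem_insert.mp ht with rfl | ht
      · simpa using h1 φ hφ hg.le
      · obtain ⟨ψ, hψ, rfl⟩ := Finset.mem_image.mp ht
        obtain ⟨hψ, hψg⟩ := Finset.mem_filter.mp hψ
        have := h2 ψ hψ φ hφ hψg hg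
        have e : φ x - ψ x / ψ g * φ g = (ψ g * φ x - φ g * ψ x) / ψ g := by
          field_simp
        rw [e]
        exact div_nonpos_of_nonpos_of_nonneg this hψg.le
    · have := h1 φ hφ hg.le
      rw [hg]
      linarith
    · have := (div_le_iff₀ hg).mp (hmax' φ hφ hg)
      linarith
  · rintro ⟨t, ht, hs⟩ φ hφ
    rcases Finset.mem_union.mp hφ with hφ | hφ
    · obtain ⟨hφ, hg⟩ := Finset.mem_filter.mp hφ
      have := hs φ hφ
      rw [map_sub, map_smul, smul_eq_mul] at this
      nlinarith
    · obtain ⟨⟨ψ, χ⟩, hp, rfl⟩ := Finset.mem_image.mp hφ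
      obtain ⟨hp, hψ, hχ⟩ := Finset.mem_filter.mp hp
      have h1 := hs _ (Finset.mem_product.mp hp).1
      have h2 := hs _ (Finset.mem_product.mp hp).2
      simp only [map_sub, map_smul, smul_eq_mul, LinearMap.sub_apply,
        LinearMap.smul_apply] at h1 h2 hψ hχ ⊢
      nlinarith

/-- A finitely generated cone is the solution set of a finite system of linear inequalities. -/
theorem exists_finset_dual_iff_exists_sum {V : Type*} [AddCommGroup V] [Module ℝ V]
    [FiniteDimensional ℝ V] {ι : Type*} (G : Finset ι) (v : ι → V) :
    ∃ s : Finset (Module.Dual ℝ V), ∀ x, (∀ φ ∈ s, φ x ≤ 0) ↔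
      ∃ l : ι → ℝ, (∀ i, 0 ≤ l i) ∧ x = ∑ i ∈ G, l i • v i := by
  classical
  induction G using Finset.induction_on with
  | empty =>
    let b := Module.finBasis ℝ V
    refine ⟨Finset.univ.image b.coord ∪ Finset.univ.image (fun i => -b.coord i), fun x =>
      ⟨fun h => ⟨0, fun _ => le_rfl, ?_⟩, ?_⟩⟩
    · rw [Finset.sum_empty, ← b.forall_coord_eq_zero_iff]
      intro i
      have h1 := h (b.coord i) (Finset.mem_union_left _ (Finset.mem_image_of_mem _
        (Finset.mem_univ i)))
      have h2 := h (-b.coord i) (Finset.mem_union_right _ (Finset.mem_image.mpr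
        ⟨i, Finset.mem_univ i, rfl⟩))
      rw [LinearMap.neg_apply] at h2
      linarith
    · rintro ⟨l, -, rfl⟩ φ -
      simp
  | insert a G ha ih =>
    obtain ⟨s, hs⟩ := ih
    obtain ⟨s', hs'⟩ := exists_finset_dual_add_ray s (v a)
    refine ⟨s', fun x => (hs' x).trans ⟨?_, ?_⟩⟩
    · rintro ⟨t, ht, h⟩
      obtain ⟨l, hl, e⟩ := (hs _).mp h
      refine ⟨Function.update l a t, fun i => ?_, ?_⟩
      · by_cases hi : i = a
        · subst hi; simpa using ht
        · simpa [hi] using hl i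
      · rw [Finset.sum_insert ha, Function.update_self, ← sub_eq_iff_eq_add', e]
        refine Finset.sum_congr rfl fun i hi => ?_
        rw [Function.update_of_ne (ne_of_mem_of_not_mem hi ha)]
    · rintro ⟨l, hl, rfl⟩
      refine ⟨l a, hl a, (hs _).mpr ⟨l, hl, ?_⟩⟩
      rw [Finset.sum_insert ha, add_sub_cancel_left]

variable {n : ℕ}

theorem isPolyhedron_of_finset {P : Set (Fin n → ℝ)}
    (s : Finset (Module.Dual ℝ (Fin n → ℝ) × ℝ)) (h : ∀ x, x ∈ P ↔ ∀ p ∈ s, p.1 x ≤ p.2) :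
    IsPolyhedron P := by
  let e := s.equivFin.symm
  refine ⟨s.card, fun j i => (e j).1.1 (Pi.single i 1), fun j => (e j).1.2, ?_⟩
  ext x
  have hx : ∀ j, Matrix.mulVec (fun j i => (e j).1.1 (Pi.single i 1)) x j = (e j).1.1 x := by
    intro j
    rw [LinearMap.pi_apply_eq_sum_univ (e j).1.1 x]
    simp only [Matrix.mulVec, dotProduct]
    refine Finset.sum_congr rfl fun i _ => ?_
    rw [smul_eq_mul, mul_comm]
    congr 2
    ext k
    simp [Pi.single_apply, eq_comm]
  rw [h, Set.mem_ofPred_eq]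
  simp only [hx]
  refine ⟨fun h j => h _ (e j).2, fun h p hp => ?_⟩
  simpa using h (e.symm ⟨p, hp⟩)

theorem mem_one_div_smul {V : Type*} [AddCommGroup V] [Module ℝ V] {P : Set V} {c : ℝ}
    (hc : 0 < c) {x : V} : x ∈ (1 / c) • P ↔ c • x ∈ P := by
  rw [Set.mem_smul_set_iff_inv_smul_mem₀ (by positivity), one_div, inv_inv]

theorem IsPolyhedron.smul {P : Set (Fin n → ℝ)} (hP : IsPolyhedron P) {c : ℝ} (hc : 0 < c) :
    IsPolyhedron ((1 / c) • P) := by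
  obtain ⟨m, A, b, rfl⟩ := hP
  refine ⟨m, c • A, b, ?_⟩
  ext x
  rw [mem_one_div_smul hc]
  simp [Matrix.mulVec_smul, Matrix.smul_mulVec]

theorem IsPolyhedron.isClosed {P : Set (Fin n → ℝ)} (hP : IsPolyhedron P) : IsClosed P := by
  obtain ⟨m, A, b, rfl⟩ := hP
  simp only [Set.ofPred_forall]
  refine isClosed_iInter fun j => isClosed_le ?_ continuous_const
  unfold Matrix.mulVec dotProduct
  fun_prop

/-! A polyhedron in the nonnegative orthant has finitely many vertices, and each of its points is
bounded below by a convex combination of vertices. -/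

/-- The constraints of the system `A x ≤ b` that are satisfied by `x` with equality. -/
noncomputable def activeSet {m : ℕ} (A : Matrix (Fin m) (Fin n) ℝ) (b : Fin m → ℝ)
    (x : Fin n → ℝ) : Finset (Fin m) :=
  open Classical in Finset.univ.filter fun j => A.mulVec x j = b j

theorem mem_activeSet {m : ℕ} {A : Matrix (Fin m) (Fin n) ℝ} {b : Fin m → ℝ}
    {x : Fin n → ℝ} {j : Fin m} : j ∈ activeSet A b x ↔ A.mulVec x j = b j := by
  simp [activeSet]

/-- The vertices of the polyhedron `A x ≤ b`. -/
def vertexSet {m : ℕ} (A : Matrix (Fin m) (Fin n) ℝ) (b : Fin m → ℝ) : Set (Fin n → ℝ) :=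
  {x | (∀ j, A.mulVec x j ≤ b j) ∧ ∀ d, (∀ j ∈ activeSet A b x, A.mulVec d j = 0) → d = 0}

theorem finite_vertexSet {m : ℕ} (A : Matrix (Fin m) (Fin n) ℝ) (b : Fin m → ℝ) :
    (vertexSet A b).Finite := by
  refine Set.Finite.of_finite_image (f := activeSet A b) (Set.toFinite _) ?_
  intro x hx y hy hxy
  rw [← sub_eq_zero]
  refine hx.2 _ fun j hj => ?_
  have hj' : j ∈ activeSet A b y := hxy ▸ hj
  rw [mem_activeSet] at hj hj'
  rw [Matrix.mulVec_sub, Pi.sub_apply, hj, hj', sub_self]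

/-- Moving along `d` keeps the active constraints tight. A negative coordinate of `d` would
eventually push the point out of the orthant, so some new constraint must become tight; `t` is the
first time this happens. -/
theorem exists_activeSet_ssubset {m : ℕ} {A : Matrix (Fin m) (Fin n) ℝ} {b : Fin m → ℝ}
    (hP : ∀ x, (∀ j, A.mulVec x j ≤ b j) → 0 ≤ x) {x d : Fin n → ℝ}
    (hx : ∀ j, A.mulVec x j ≤ b j) (hd : ∀ j ∈ activeSet A b x, A.mulVec d j = 0) {i : Fin n}
    (hi : d i < 0) :
    ∃ t : ℝ, 0 < t ∧ (∀ j, A.mulVec (x + t • d) j ≤ b j) ∧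
      activeSet A b x ⊂ activeSet A b (x + t • d) := by
  classical
  have hA : ∀ (t : ℝ) j, A.mulVec (x + t • d) j = A.mulVec x j + t * A.mulVec d j := by
    intro t j
    simp [Matrix.mulVec_add, Matrix.mulVec_smul]
  have hne : (Finset.univ.filter fun j => 0 < A.mulVec d j).Nonempty := by
    by_contra hne
    rw [Finset.not_nonempty_iff_eq_empty, Finset.filter_eq_empty_iff] at hne
    -- At this time the coordinate `i` equals `-1`.
    have h0 : 0 ≤ (x i + 1) / (- d i) := by
      have : 0 ≤ x i := hP x hx i
      exact div_nonneg (by linarith) (by linarith)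
    have := hP (x + ((x i + 1) / (- d i)) • d) (fun j => by
      rw [hA]
      have h1 := hx j
      have h2 := not_lt.mp (hne (Finset.mem_univ j))
      nlinarith) i
    have e : (x i + 1) / (- d i) * d i = -(x i + 1) := by
      have : d i ≠ 0 := hi.ne
      field_simp
    simp only [Pi.zero_apply, Pi.add_apply, Pi.smul_apply, smul_eq_mul, e] at this
    linarith
  obtain ⟨j₀, hj₀, hmin⟩ := Finset.exists_min_image _
    (fun j => (b j - A.mulVec x j) / A.mulVec d j) hne
  have hj₀ := (Finset.mem_filter.mp hj₀).2
  have hlt : A.mulVec x j₀ < b j₀ := by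
    refine lt_of_le_of_ne (hx j₀) fun h => ?_
    exact hj₀.ne' (hd j₀ (mem_activeSet.mpr h))
  have ht : 0 < (b j₀ - A.mulVec x j₀) / A.mulVec d j₀ := div_pos (by linarith) hj₀
  refine ⟨_, ht, fun j => ?_, ?_⟩
  · rw [hA]
    by_cases hj : 0 < A.mulVec d j
    · have := (le_div_iff₀ hj).mp (hmin j (Finset.mem_filter.mpr ⟨Finset.mem_univ _, hj⟩))
      linarith
    · have := hx j
      nlinarith
  · refine Finset.ssubset_iff_of_subset (fun j hj => ?_) |>.mpr ⟨j₀, ?_, ?_⟩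
    · rw [mem_activeSet, hA, hd j hj, mul_zero, add_zero]
      exact mem_activeSet.mp hj
    · rw [mem_activeSet, hA, div_mul_cancel₀ _ hj₀.ne']
      ring
    · rw [mem_activeSet]
      exact hlt.ne

/-- Induction on the number of inactive constraints. At a non-vertex, some `d ≠ 0` preserves the
active ones. If `d` has both signs, `x` lies between two points with more active constraints, one in
each direction; otherwise a step along whichever of `d`, `-d` is nonpositive only lowers `x`. -/
theorem exists_mem_convexHull_vertexSet_le {m : ℕ} {A : Matrix (Fin m) (Fin n) ℝ}
    {b : Fin m → ℝ} (hP : ∀ x, (∀ j, A.mulVec x j ≤ b j) → 0 ≤ x) {x : Fin n → ℝ}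
    (hx : ∀ j, A.mulVec x j ≤ b j) : ∃ y ∈ convexHull ℝ (vertexSet A b), y ≤ x := by
  induction hN : (activeSet A b x)ᶜ.card using Nat.strong_induction_on generalizing x with
  | _ N ih =>
  subst hN
  by_cases hv : x ∈ vertexSet A b
  · exact ⟨x, subset_convexHull _ _ hv, le_rfl⟩
  have hstep : ∀ d : Fin n → ℝ, (∀ j ∈ activeSet A b x, A.mulVec d j = 0) → (∃ i, d i < 0) →
      ∃ t : ℝ, 0 < t ∧ ∃ y ∈ convexHull ℝ (vertexSet A b), y ≤ x + t • d := by
    rintro d hd ⟨i, hi⟩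
    obtain ⟨t, ht, hy, hs⟩ := exists_activeSet_ssubset hP hx hd hi
    exact ⟨t, ht, ih _ (Finset.card_lt_card (Finset.compl_ssubset_compl.mpr hs)) hy rfl⟩
  obtain ⟨d, hd, hd0⟩ : ∃ d, (∀ j ∈ activeSet A b x, A.mulVec d j = 0) ∧ d ≠ 0 := by
    by_contra! h
    exact hv ⟨hx, h⟩
  have hd' : ∀ j ∈ activeSet A b x, A.mulVec (-d) j = 0 := fun j hj => by
    rw [Matrix.mulVec_neg, Pi.neg_apply, hd j hj, neg_zero]
  have hmono : ∀ e : Fin n → ℝ, (∀ j ∈ activeSet A b x, A.mulVec e j = 0) → (∃ i, e i < 0) →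
      e ≤ 0 → ∃ y ∈ convexHull ℝ (vertexSet A b), y ≤ x := by
    intro e he hi he0
    obtain ⟨t, ht, y, hy, hyx⟩ := hstep e he hi
    refine ⟨y, hy, hyx.trans ?_⟩
    have := smul_nonpos_of_nonneg_of_nonpos ht.le he0
    simpa using this
  by_cases hneg : ∃ i, d i < 0
  · by_cases hpos : ∃ i, 0 < d i
    · obtain ⟨t, ht, y, hy, hyx⟩ := hstep d hd hneg
      obtain ⟨u, hu, z, hz, hzx⟩ := hstep (-d) hd' (by simpa using hpos)
      -- With these weights the displacements `t • d` and `-(u • d)` cancel.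
      refine ⟨(u / (t + u)) • y + (t / (t + u)) • z, convex_convexHull ℝ _ hy hz (by positivity)
        (by positivity) (by field_simp; ring), fun i => ?_⟩
      have h1 := hyx i
      have h2 := hzx i
      simp only [Pi.add_apply, Pi.smul_apply, Pi.neg_apply, smul_eq_mul] at h1 h2 ⊢
      have e : u / (t + u) * y i + t / (t + u) * z i = (u * y i + t * z i) / (t + u) := by
        field_simp
      rw [e, div_le_iff₀ (by positivity)]
      nlinarith
    · exact hmono d hd hneg fun i => not_lt.mp fun h => hpos ⟨i, h⟩
  · push Not at hneg
    obtain ⟨i, hi⟩ := Function.ne_iff.mp hd0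
    refine hmono (-d) hd' ⟨i, ?_⟩ fun i => by simpa using hneg i
    have := lt_of_le_of_ne (hneg i) (Ne.symm hi)
    simpa using this

end Polyhedra

/-! ### Newton polyhedra -/

section Newton

variable {n : ℕ} {𝕜 : Type*} [Field 𝕜]

/-- An exponent vector as a point of `ℝⁿ`. -/
def realVec (a : Fin n →₀ ℕ) : Fin n → ℝ := fun i => (a i : ℝ)

theorem realVec_apply (a : Fin n →₀ ℕ) (i : Fin n) : realVec a i = a i := rfl

theorem realVec_add (a b : Fin n →₀ ℕ) : realVec (a + b) = realVec a + realVec b := by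
  ext i; simp [realVec]

theorem realVec_nsmul (m : ℕ) (a : Fin n →₀ ℕ) : realVec (m • a) = (m : ℝ) • realVec a := by
  ext i; simp [realVec]

theorem realVec_nonneg (a : Fin n →₀ ℕ) : 0 ≤ realVec a := fun _ => Nat.cast_nonneg _

theorem realVec_mem_exponents {I : Ideal (MvPolynomial (Fin n) 𝕜)} {a : Fin n →₀ ℕ}
    (h : MvPolynomial.monomial a (1 : 𝕜) ∈ I) : realVec a ∈ exponents I := ⟨a, h, rfl⟩

theorem realVec_mem_newtonPolyhedron {I : Ideal (MvPolynomial (Fin n) 𝕜)} {a : Fin n →₀ ℕ}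
    (h : MvPolynomial.monomial a (1 : 𝕜) ∈ I) : realVec a ∈ newtonPolyhedron I :=
  subset_convexHull _ _ (realVec_mem_exponents h)

theorem convex_newtonPolyhedron (I : Ideal (MvPolynomial (Fin n) 𝕜)) :
    Convex ℝ (newtonPolyhedron I) := convex_convexHull _ _

theorem newtonPolyhedron_nonneg {I : Ideal (MvPolynomial (Fin n) 𝕜)} {x : Fin n → ℝ}
    (hx : x ∈ newtonPolyhedron I) : 0 ≤ x := by
  refine convexHull_min (t := Set.Ici 0) ?_ (convex_Ici 0) hx
  rintro _ ⟨a, -, rfl⟩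
  exact realVec_nonneg a

theorem monomial_mem_of_le {I : Ideal (MvPolynomial (Fin n) 𝕜)} {a b : Fin n →₀ ℕ}
    (h : MvPolynomial.monomial a (1 : 𝕜) ∈ I) (hab : a ≤ b) :
    MvPolynomial.monomial b (1 : 𝕜) ∈ I := by
  have := I.mul_mem_left (MvPolynomial.monomial (b - a) (1 : 𝕜)) h
  rwa [MvPolynomial.monomial_mul, tsub_add_cancel_of_le hab, one_mul] at this

theorem mem_convexHull_range_natCast {r : ℝ} (hr : 0 ≤ r) :
    r ∈ convexHull ℝ (Set.range ((↑) : ℕ → ℝ)) := by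
  have h : segment ℝ ((⌊r⌋₊ : ℕ) : ℝ) ((⌊r⌋₊ + 1 : ℕ) : ℝ) ⊆
      convexHull ℝ (Set.range ((↑) : ℕ → ℝ)) :=
    segment_subset_convexHull ⟨_, rfl⟩ ⟨_, rfl⟩
  refine h ?_
  rw [segment_eq_Icc (by simp)]
  exact ⟨Nat.floor_le hr, by push_cast; exact (Nat.lt_floor_add_one r).le⟩

/-- The orthant is the convex hull of ℕⁿ, convex hulls commute with Minkowski sums, and the
exponents of an ideal are stable under adding ℕⁿ. -/
theorem newtonPolyhedron_mono_le {I : Ideal (MvPolynomial (Fin n) 𝕜)} {x y : Fin n → ℝ}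
    (hx : x ∈ newtonPolyhedron I) (hxy : x ≤ y) : y ∈ newtonPolyhedron I := by
  have hy : y - x ∈ convexHull ℝ
      (Set.univ.pi fun _ : Fin n => Set.range ((↑) : ℕ → ℝ)) := by
    rw [convexHull_pi]
    intro i _
    exact mem_convexHull_range_natCast (sub_nonneg.mpr (hxy i))
  have h := Set.add_mem_add hx hy
  rw [add_sub_cancel, newtonPolyhedron, ← convexHull_add] at h
  refine convexHull_mono ?_ h
  rintro _ ⟨_, ⟨a, ha, rfl⟩, z, hz, rfl⟩
  choose f hf using fun i => hz i trivial
  refine ⟨a + Finsupp.equivFunOnFinite.symm f, monomial_mem_of_le ha le_self_add, ?_⟩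
  ext i
  simp [← hf]

theorem IsMonomialIdeal.exists_finset {I : Ideal (MvPolynomial (Fin n) 𝕜)}
    (hI : IsMonomialIdeal I) : ∃ G : Finset (Fin n →₀ ℕ),
      I = Ideal.span ((fun a => MvPolynomial.monomial a (1 : 𝕜)) '' (G : Set (Fin n →₀ ℕ))) := by
  classical
  obtain ⟨S, rfl⟩ := hI
  obtain ⟨s', hs', e⟩ := (Submodule.fg_span_iff_fg_span_finset_subset _).mp
    (IsNoetherian.noetherian (Ideal.span
      ((fun a => MvPolynomial.monomial a (1 : 𝕜)) '' S)))
  obtain ⟨G, -, rfl⟩ := Finset.subset_set_image_iff.mp hs'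
  refine ⟨G, e.trans ?_⟩
  rw [Finset.coe_image]

theorem mem_span_monomial_iff {S : Set (Fin n →₀ ℕ)} {a : Fin n →₀ ℕ} :
    MvPolynomial.monomial a (1 : 𝕜) ∈
      Ideal.span ((fun a => MvPolynomial.monomial a (1 : 𝕜)) '' S) ↔ ∃ g ∈ S, g ≤ a := by
  classical
  rw [MvPolynomial.mem_ideal_span_monomial_image]
  simp [MvPolynomial.support_monomial]

/-- An ideal is *term-wise* if it contains the monomials of all of its elements. -/
def IsTermwise (I : Ideal (MvPolynomial (Fin n) 𝕜)) : Prop :=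
  ∀ f ∈ I, ∀ a ∈ f.support, MvPolynomial.monomial a (1 : 𝕜) ∈ I

theorem IsMonomialIdeal.isTermwise {I : Ideal (MvPolynomial (Fin n) 𝕜)}
    (hI : IsMonomialIdeal I) : IsTermwise I := by
  obtain ⟨S, rfl⟩ := hI
  intro f hf a ha
  rw [mem_span_monomial_iff]
  exact MvPolynomial.mem_ideal_span_monomial_image.mp hf a ha

theorem mem_of_monomials_mem {I : Ideal (MvPolynomial (Fin n) 𝕜)} {f : MvPolynomial (Fin n) 𝕜}
    (h : ∀ a ∈ f.support, MvPolynomial.monomial a (1 : 𝕜) ∈ I) : f ∈ I := by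
  rw [f.as_sum]
  refine Ideal.sum_mem _ fun a ha => ?_
  have := I.mul_mem_left (MvPolynomial.C (f.coeff a)) (h a ha)
  rwa [MvPolynomial.C_mul_monomial, mul_one] at this

theorem mem_newtonPolyhedron_span_iff {G : Finset (Fin n →₀ ℕ)} {x : Fin n → ℝ} :
    x ∈ newtonPolyhedron (Ideal.span
        ((fun a => MvPolynomial.monomial a (1 : 𝕜)) '' (G : Set (Fin n →₀ ℕ)))) ↔
      ∃ l : (Fin n →₀ ℕ) → ℝ, (∀ g, 0 ≤ l g) ∧ ∑ g ∈ G, l g = 1 ∧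
        ∑ g ∈ G, l g • realVec g ≤ x := by
  classical
  constructor
  · intro hx
    refine convexHull_min (t := {x | ∃ l : (Fin n →₀ ℕ) → ℝ, (∀ g, 0 ≤ l g) ∧
      ∑ g ∈ G, l g = 1 ∧ ∑ g ∈ G, l g • realVec g ≤ x}) ?_ ?_ hx
    · rintro _ ⟨a, ha, rfl⟩
      obtain ⟨g, hg, hga⟩ := mem_span_monomial_iff.mp ha
      have hg : g ∈ G := hg
      refine ⟨Pi.single g 1, fun g' => ?_, ?_, ?_⟩
      · by_cases h : g' = g <;> simp [h]
      · simp [Pi.single_apply, hg]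
      · simp only [Pi.single_apply, ite_smul, one_smul, zero_smul, Finset.sum_ite_eq', hg, if_true]
        exact fun i => Nat.cast_le.mpr (hga i)
    · rintro x ⟨l, hl, hl1, hlx⟩ y ⟨m, hm, hm1, hmy⟩ s t hs ht hst
      refine ⟨s • l + t • m, fun g => ?_, ?_, ?_⟩
      · exact add_nonneg (mul_nonneg hs (hl g)) (mul_nonneg ht (hm g))
      · simp [Finset.sum_add_distrib, ← Finset.mul_sum, hl1, hm1, hst]
      · have e : ∑ g ∈ G, (s • l + t • m) g • realVec g =
            s • ∑ g ∈ G, l g • realVec g + t • ∑ g ∈ G, m g • realVec g := by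
          simp [add_smul, Finset.sum_add_distrib, Finset.smul_sum, mul_smul]
        rw [e]
        exact add_le_add (smul_le_smul_of_nonneg_left hlx hs)
          (smul_le_smul_of_nonneg_left hmy ht)
  · rintro ⟨l, hl, hl1, hlx⟩
    refine newtonPolyhedron_mono_le ?_ hlx
    refine (convex_newtonPolyhedron _).sum_mem (fun g _ => hl g) hl1 fun g hg => ?_
    exact realVec_mem_newtonPolyhedron (Ideal.subset_span ⟨g, hg, rfl⟩)

/-- Homogenization: the polyhedron is the slice at height 1 of the cone generated by the points `(g,
1)` and the directions `(e_j, 0)`. -/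
theorem IsMonomialIdeal.isPolyhedron_newtonPolyhedron {I : Ideal (MvPolynomial (Fin n) 𝕜)}
    (hI : IsMonomialIdeal I) : IsPolyhedron (newtonPolyhedron I) := by
  classical
  obtain ⟨G, rfl⟩ := hI.exists_finset
  obtain ⟨s, hs⟩ := exists_finset_dual_iff_exists_sum (V := (Fin n → ℝ) × ℝ)
    (G.disjSum (Finset.univ : Finset (Fin n)))
    (Sum.elim (fun g => (realVec g, 1)) (fun j => (Pi.single j 1, 0)))
  refine isPolyhedron_of_finset
    (s.image fun φ : Module.Dual ℝ ((Fin n → ℝ) × ℝ) => (φ.comp (LinearMap.inl ℝ _ ℝ), -φ (0, 1)))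
    fun x => ?_
  rw [Finset.forall_mem_image]
  have h1 : (∀ φ ∈ s, (φ.comp (LinearMap.inl ℝ (Fin n → ℝ) ℝ)) x ≤ -φ (0, 1)) ↔
      ∀ φ ∈ s, φ (x, 1) ≤ 0 := by
    refine forall₂_congr fun φ _ => ?_
    have : φ (x, 1) = φ (x, 0) + φ (0, 1) := by rw [← map_add]; simp
    rw [this, LinearMap.comp_apply, LinearMap.inl_apply, le_neg_iff_add_nonpos_right]
  rw [mem_newtonPolyhedron_span_iff, h1, hs]
  simp only [Finset.sum_disjSum, Sum.elim_inl, Sum.elim_inr, Prod.ext_iff, Prod.fst_add,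
    Prod.snd_add, Prod.fst_sum, Prod.snd_sum, Prod.smul_fst, Prod.smul_snd, smul_eq_mul, mul_one,
    mul_zero, Finset.sum_const_zero, add_zero]
  constructor
  · rintro ⟨l, hl, hl1, hlx⟩
    refine ⟨Sum.elim l (x - ∑ g ∈ G, l g • realVec g), ?_, ?_, by simpa using hl1.symm⟩
    · rintro (g | j)
      · exact hl g
      · exact sub_nonneg.mpr (hlx j)
    · simp only [Sum.elim_inl, Sum.elim_inr]
      rw [← pi_eq_sum_univ' (x - ∑ g ∈ G, l g • realVec g)]
      abel
  · rintro ⟨l, hl, hlx, hl1⟩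
    refine ⟨fun g => l (Sum.inl g), fun g => hl _, hl1.symm, ?_⟩
    rw [hlx, le_add_iff_nonneg_right]
    exact Finset.sum_nonneg fun j _ => smul_nonneg (hl _) (Pi.single_nonneg.mpr zero_le_one)

theorem smul_newtonPolyhedron_subset (I : Ideal (MvPolynomial (Fin n) 𝕜)) (k : ℕ) :
    (k : ℝ) • newtonPolyhedron I ⊆ newtonPolyhedron (I ^ k) := by
  rw [newtonPolyhedron, ← convexHull_smul]
  refine convexHull_mono ?_
  rintro _ ⟨_, ⟨a, ha, rfl⟩, rfl⟩
  refine ⟨k • a, ?_, (realVec_nsmul k a).symm⟩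
  have := Ideal.pow_mem_pow ha k
  rwa [MvPolynomial.monomial_pow, one_pow] at this

theorem newtonPolyhedron_mono {I J : Ideal (MvPolynomial (Fin n) 𝕜)} (h : I ≤ J) :
    newtonPolyhedron I ⊆ newtonPolyhedron J := by
  refine convexHull_mono ?_
  rintro _ ⟨a, ha, rfl⟩
  exact ⟨a, h ha, rfl⟩

end Newton

/-! ### Integral closure and Newton polyhedra -/

section IntegralClosureNewton

variable {n : ℕ} {𝕜 : Type*} [Field 𝕜]

/-- The weight is minus the normal of a violated inequality. It is nonnegative because the
polyhedron is closed upwards: a positive entry of the normal would let the inequality be broken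
inside the polyhedron. -/
theorem exists_separating_weight {I : Ideal (MvPolynomial (Fin n) 𝕜)} (hI : IsMonomialIdeal I)
    {x : Fin n → ℝ} (hx : x ∉ newtonPolyhedron I) :
    ∃ (w : Fin n → ℝ) (u : ℝ), 0 ≤ w ∧ (∀ y ∈ newtonPolyhedron I, u ≤ w ⬝ᵥ y) ∧ w ⬝ᵥ x < u := by
  rcases (newtonPolyhedron I).eq_empty_or_nonempty with h0 | ⟨x₀, hx₀⟩
  · exact ⟨0, 1, le_rfl, by simp [h0], by simp⟩
  obtain ⟨m, A, b, hP⟩ := hI.isPolyhedron_newtonPolyhedron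
  have hmem : ∀ y, y ∈ newtonPolyhedron I ↔ ∀ j, A.mulVec y j ≤ b j := fun y => by rw [hP]; rfl
  rw [hmem] at hx
  push Not at hx
  obtain ⟨j, hj⟩ := hx
  have hA : ∀ y, A.mulVec y j = A j ⬝ᵥ y := fun _ => rfl
  refine ⟨-A j, -b j, fun i => ?_, fun y hy => ?_, ?_⟩
  · by_contra hi
    have hi : 0 < A j i := by simpa using hi
    have h1 := (hmem x₀).mp hx₀ j
    have ht : 0 ≤ (b j - A.mulVec x₀ j + 1) / A j i := div_nonneg (by linarith) hi.le
    have h2 := (hmem _).mp (newtonPolyhedron_mono_le hx₀ (y := x₀ + Pi.single i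
      ((b j - A.mulVec x₀ j + 1) / A j i))
      (le_add_of_nonneg_right (Pi.single_nonneg.mpr ht))) j
    rw [hA, dotProduct_add, dotProduct_single, mul_div_cancel₀ _ hi.ne', ← hA] at h2
    linarith
  · rw [neg_dotProduct, ← hA]
    exact neg_le_neg ((hmem y).mp hy j)
  · rw [neg_dotProduct, ← hA]
    exact neg_lt_neg hj

/-! ### Monomial valuations with real weights -/

/-- The ring homomorphism to Hahn series that multiplies each monomial by a formal power whose
exponent is the weight of the monomial. -/
noncomputable def weightHom (w : Fin n → ℝ) :
    MvPolynomial (Fin n) 𝕜 →+* HahnSeries ℝ (MvPolynomial (Fin n) 𝕜) :=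
  MvPolynomial.eval₂Hom (HahnSeries.C.comp MvPolynomial.C)
    fun j => HahnSeries.single (w j) (MvPolynomial.X j)

theorem prod_single {ι Γ S : Type*} [AddCommMonoid Γ] [PartialOrder Γ]
    [IsOrderedCancelAddMonoid Γ] [CommSemiring S] (s : Finset ι) (g : ι → Γ) (r : ι → S) :
    ∏ i ∈ s, HahnSeries.single (g i) (r i) =
      HahnSeries.single (∑ i ∈ s, g i) (∏ i ∈ s, r i) := by
  classical
  induction s using Finset.induction_on with
  | empty => simp
  | insert a s ha ih =>
    rw [Finset.prod_insert ha, ih, HahnSeries.single_mul_single, Finset.sum_insert ha,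
      Finset.prod_insert ha]

theorem weightHom_monomial (w : Fin n → ℝ) (a : Fin n →₀ ℕ) (c : 𝕜) :
    weightHom w (MvPolynomial.monomial a c) =
      HahnSeries.single (w ⬝ᵥ realVec a) (MvPolynomial.monomial a c) := by
  rw [weightHom, MvPolynomial.coe_eval₂Hom, MvPolynomial.eval₂_monomial,
    Finsupp.prod_fintype _ _ (by simp)]
  simp only [HahnSeries.single_pow]
  rw [prod_single, RingHom.comp_apply, HahnSeries.C_apply, HahnSeries.single_mul_single, zero_add,
    MvPolynomial.monomial_eq, Finsupp.prod_fintype _ _ (by simp)]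
  congr 2
  simp [dotProduct, realVec, mul_comm]

/-- The monomial valuation with weights `w`. -/
noncomputable def weightVal (w : Fin n → ℝ) (f : MvPolynomial (Fin n) 𝕜) : WithTop ℝ :=
  HahnSeries.addVal ℝ (MvPolynomial (Fin n) 𝕜) (weightHom w f)

theorem weightVal_mul (w : Fin n → ℝ) (f g : MvPolynomial (Fin n) 𝕜) :
    weightVal w (f * g) = weightVal w f + weightVal w g := by
  rw [weightVal, map_mul, AddValuation.map_mul]; rfl

theorem weightVal_pow (w : Fin n → ℝ) (f : MvPolynomial (Fin n) 𝕜) (m : ℕ) :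
    weightVal w (f ^ m) = m • weightVal w f := by
  rw [weightVal, map_pow, AddValuation.map_pow]; rfl

theorem le_weightVal_sum {ι : Type*} {w : Fin n → ℝ} {s : Finset ι}
    {f : ι → MvPolynomial (Fin n) 𝕜} {r : WithTop ℝ} (h : ∀ i ∈ s, r ≤ weightVal w (f i)) :
    r ≤ weightVal w (∑ i ∈ s, f i) := by
  rw [weightVal, map_sum]
  exact AddValuation.map_le_sum _ h

theorem lt_weightVal_sum {ι : Type*} {w : Fin n → ℝ} {s : Finset ι}
    {f : ι → MvPolynomial (Fin n) 𝕜} {r : ℝ} (h : ∀ i ∈ s, r < weightVal w (f i)) :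
    r < weightVal w (∑ i ∈ s, f i) := by
  rw [weightVal, map_sum]
  exact AddValuation.map_lt_sum' _ (WithTop.coe_lt_top r) h

theorem le_weightVal {w : Fin n → ℝ} {f : MvPolynomial (Fin n) 𝕜} {r : ℝ}
    (h : ∀ a ∈ f.support, r ≤ w ⬝ᵥ realVec a) : r ≤ weightVal w f := by
  rw [f.as_sum]
  refine le_weightVal_sum fun a ha => ?_
  rw [weightVal, weightHom_monomial, HahnSeries.addVal_apply]
  exact (WithTop.coe_le_coe.mpr (h a ha)).trans HahnSeries.orderTop_single_le

/-- `weightHom` keeps each monomial as a coefficient, so distinct monomials of equal weight cannot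
cancel. -/
theorem weightVal_le {w : Fin n → ℝ} {f : MvPolynomial (Fin n) 𝕜} {a : Fin n →₀ ℕ}
    (ha : a ∈ f.support) : weightVal w f ≤ ((w ⬝ᵥ realVec a : ℝ) : WithTop ℝ) := by
  classical
  refine HahnSeries.addVal_le_of_coeff_ne_zero fun h => ?_
  have hf : weightHom w f = ∑ b ∈ f.support,
      HahnSeries.single (w ⬝ᵥ realVec b) (MvPolynomial.monomial b (f.coeff b)) := by
    conv_lhs => rw [f.as_sum, map_sum]
    exact Finset.sum_congr rfl fun b _ => weightHom_monomial _ _ _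
  rw [hf, HahnSeries.coeff_sum] at h
  replace h := congr(MvPolynomial.coeff a $h)
  rw [MvPolynomial.coeff_sum, Finset.sum_eq_single a] at h
  · simp only [HahnSeries.coeff_single_same, MvPolynomial.coeff_monomial, if_true,
      MvPolynomial.coeff_zero] at h
    exact MvPolynomial.mem_support_iff.mp ha h
  · intro b _ hb
    rw [HahnSeries.coeff_single]
    split_ifs <;> simp [MvPolynomial.coeff_monomial, hb]
  · exact fun h => absurd ha h

theorem le_weightVal_of_mem_pow {w : Fin n → ℝ} (hw : 0 ≤ w) {u : ℝ}
    {I : Ideal (MvPolynomial (Fin n) 𝕜)} (hI : IsTermwise I)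
    (hu : ∀ y ∈ newtonPolyhedron I, u ≤ w ⬝ᵥ y) (m : ℕ) :
    ∀ f ∈ I ^ m, ((m * u : ℝ) : WithTop ℝ) ≤ weightVal w f := by
  induction m with
  | zero =>
    intro f _
    refine le_weightVal fun a _ => ?_
    rw [Nat.cast_zero, zero_mul]
    exact dotProduct_nonneg_of_nonneg hw (realVec_nonneg a)
  | succ m ih =>
    intro f hf
    rw [pow_succ] at hf
    refine Submodule.mul_induction_on hf (fun g hg h hh => ?_) fun g h hg hh => ?_
    · rw [weightVal_mul, Nat.cast_succ, add_mul, one_mul, WithTop.coe_add]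
      refine add_le_add (ih g hg) (le_weightVal fun a ha => hu _ ?_)
      exact realVec_mem_newtonPolyhedron (hI h hh a ha)
    · have := le_weightVal_sum (w := w) (s := Finset.univ) (f := ![g, h])
        (r := (((m + 1 : ℕ) * u : ℝ) : WithTop ℝ)) (by
          intro i _
          fin_cases i
          · exact hg
          · exact hh)
      simpa using this

/-- Otherwise a separating weight gives `f` a value `r < k * u`. In an integral equation of degree
d, the term with `f ^ i`, i < d, has value at least `(d - i) * k * u + i * r > d * r`, so these
terms cannot sum to `-f ^ d`. -/
theorem exists_mem_newtonPolyhedron_of_mem_idealClosure_pow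
    {I : Ideal (MvPolynomial (Fin n) 𝕜)} (hI : IsMonomialIdeal I) {k : ℕ} (hk : 0 < k)
    {f : MvPolynomial (Fin n) 𝕜} (hf : f ∈ idealClosure (I ^ k)) {a : Fin n →₀ ℕ}
    (ha : a ∈ f.support) : (k : ℝ)⁻¹ • realVec a ∈ newtonPolyhedron I := by
  have hk' : (0 : ℝ) < k := Nat.cast_pos.mpr hk
  by_contra hx
  obtain ⟨w, u, hw, hu, hlt⟩ := exists_separating_weight hI hx
  rw [dotProduct_smul, smul_eq_mul, inv_mul_lt_iff₀ hk'] at hlt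
  have hv := weightVal_le (w := w) ha
  obtain ⟨r, hr⟩ := WithTop.ne_top_iff_exists.mp (ne_top_of_le_ne_top WithTop.coe_ne_top hv)
  have hru : r < k * u := by
    rw [← hr, WithTop.coe_le_coe] at hv
    exact hv.trans_lt hlt
  obtain ⟨p, hp, hc, h0⟩ := hf
  rw [Polynomial.eval_eq_sum_range, Finset.sum_range_succ, hp.coeff_natDegree, one_mul] at h0
  have hfd : weightVal w (f ^ p.natDegree) = ((p.natDegree * r : ℝ) : WithTop ℝ) := by
    rw [weightVal_pow, ← hr, ← WithTop.coe_nsmul, nsmul_eq_mul]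
  rw [eq_neg_of_add_eq_zero_right h0, ← Finset.sum_neg_distrib] at hfd
  refine hfd.not_gt (lt_weightVal_sum fun i hi => ?_)
  have hi := Finset.mem_range.mp hi
  rw [← neg_mul, weightVal_mul, weightVal_pow, ← hr, ← WithTop.coe_nsmul, nsmul_eq_mul]
  have h1 := le_weightVal_of_mem_pow hw hI.isTermwise hu (k * (p.natDegree - i))
    (-p.coeff i) (by rw [pow_mul]; exact neg_mem (hc i))
  refine lt_of_lt_of_le ?_ (add_le_add_left h1 _)
  rw [← WithTop.coe_add, WithTop.coe_lt_coe]
  push_cast [Nat.cast_sub hi.le]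
  have : (i : ℝ) < p.natDegree := Nat.cast_lt.mpr hi
  nlinarith

/-! ### Lattice points of the Newton polyhedron are integral -/

theorem isIntegralOverIdeal_of_pow_mem {R : Type*} [CommRing R] {I : Ideal R} {x : R} {m : ℕ}
    (hm : m ≠ 0) (hx : x ^ m ∈ I ^ m) : IsIntegralOverIdeal I x := by
  rcases subsingleton_or_nontrivial R with hR | hR
  · exact .of_subsingleton _ _
  refine ⟨Polynomial.X ^ m - Polynomial.C (x ^ m), Polynomial.monic_X_pow_sub_C _ hm, fun i => ?_,
    by simp⟩
  rw [Polynomial.natDegree_X_pow_sub_C, Polynomial.coeff_sub, Polynomial.coeff_X_pow,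
    Polynomial.coeff_C]
  refine sub_mem ?_ ?_
  · split_ifs with h
    · simp [h]
    · exact zero_mem _
  · split_ifs with h
    · simpa [h] using hx
    · exact zero_mem _

/-- An integral point in the convex hull of integral points is a convex combination of them with
rational coefficients. -/
theorem exists_nat_combination {E : Set (Fin n →₀ ℕ)} {a : Fin n →₀ ℕ}
    (ha : realVec a ∈ convexHull ℝ (realVec '' E)) :
    ∃ (ι : Type) (_ : Fintype ι) (e : ι → Fin n →₀ ℕ) (m : ι → ℕ), (∀ i, e i ∈ E) ∧
      ∑ i, m i ≠ 0 ∧ (∑ i, m i) • a = ∑ i, m i • e i := by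
  classical
  obtain ⟨ι, _, z, w, hz, hind, hw, hw1, hwa⟩ := eq_pos_convex_span_of_mem_convexHull ha
  choose e he hez using fun i => hz ⟨i, rfl⟩
  -- A ℚ-linear retraction ℝ → ℚ turns the real weights into rational solutions of the same integral
  -- linear system. Affine independence makes the solution unique, so the weights were already
  -- rational.
  obtain ⟨π, hπ⟩ := LinearMap.exists_leftInverse_of_injective (Algebra.linearMap ℚ ℝ)
    (LinearMap.ker_eq_bot.mpr (algebraMap ℚ ℝ).injective)
  have hπq : ∀ q : ℚ, π (q : ℝ) = q := fun q => LinearMap.congr_fun hπ q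
  have hπmul : ∀ (x : ℝ) (m : ℕ), π (x * m) = π x * m := fun x m => by
    rw [mul_comm, ← nsmul_eq_mul, map_nsmul, nsmul_eq_mul, mul_comm]
  have hq1 : ∑ i, π (w i) = 1 := by
    rw [← map_sum, hw1]
    simpa using hπq 1
  have hqa : ∀ j, ∑ i, π (w i) * (e i j : ℚ) = a j := by
    intro j
    have h := congr(π ($hwa j))
    rw [realVec_apply, Finset.sum_apply, map_sum] at h
    have h2 : π ((a j : ℕ) : ℝ) = a j := by simpa using hπq (a j)
    rw [h2] at h
    rw [← h]
    refine Finset.sum_congr rfl fun i _ => ?_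
    rw [← hez, Pi.smul_apply, smul_eq_mul, realVec_apply, hπmul]
  have hwq : ∀ i, w i = (π (w i) : ℝ) := by
    intro i
    rw [← sub_eq_zero]
    refine affineIndependent_iff.mp hind Finset.univ (fun i => w i - (π (w i) : ℝ)) ?_ ?_ i
      (Finset.mem_univ i)
    · rw [Finset.sum_sub_distrib, hw1, ← Rat.cast_sum, hq1]
      simp
    · simp only [sub_smul]
      rw [Finset.sum_sub_distrib, hwa, sub_eq_zero]
      ext j
      rw [Finset.sum_apply, realVec_apply]
      have := congr(($(hqa j) : ℝ))
      push_cast at this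
      rw [← this]
      exact Finset.sum_congr rfl fun i _ => by rw [← hez]; rfl
  have hqpos : ∀ i, 0 ≤ π (w i) := fun i => by
    have := hw i
    rw [hwq i] at this
    exact_mod_cast this.le
  let D := ∏ i, (π (w i)).den
  have hD : D ≠ 0 := Finset.prod_ne_zero_iff.mpr fun i _ => (π (w i)).den_ne_zero
  have hm : ∀ i, ∃ m : ℕ, (m : ℚ) = D * π (w i) := by
    intro i
    obtain ⟨c, hc⟩ : (π (w i)).den ∣ D := Finset.dvd_prod_of_mem _ (Finset.mem_univ i)
    refine ⟨c * (π (w i)).num.toNat, ?_⟩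
    have h1 : (((π (w i)).num.toNat : ℤ) : ℚ) = (π (w i)).num := by
      rw [Int.toNat_of_nonneg (Rat.num_nonneg.mpr (hqpos i))]
    rw [hc, Nat.cast_mul, Nat.cast_mul]
    have h2 : ((π (w i)).den : ℚ) * π (w i) = (π (w i)).num := Rat.den_mul_eq_num _
    rw [Int.cast_natCast] at h1
    rw [h1, ← h2]
    ring
  choose m hm using hm
  have hsum : ∑ i, m i = D := by
    have : ((∑ i, m i : ℕ) : ℚ) = D := by
      rw [Nat.cast_sum]
      simp only [hm]
      rw [← Finset.mul_sum, hq1, mul_one]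
    exact_mod_cast this
  let ε := Fintype.equivFin ι
  refine ⟨Fin (Fintype.card ι), inferInstance, e ∘ ε.symm, m ∘ ε.symm, fun i => he _, ?_, ?_⟩
  · simpa only [Function.comp_apply, ε.symm.sum_comp m, hsum] using hD
  · simp only [Function.comp_apply]
    rw [ε.symm.sum_comp m, ε.symm.sum_comp fun i => m i • e i, hsum]
    ext j
    have : ((D * a j : ℕ) : ℚ) = ((∑ i, m i * e i j : ℕ) : ℚ) := by
      push_cast
      rw [← hqa j, Finset.mul_sum]
      exact Finset.sum_congr rfl fun i _ => by rw [hm]; ring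
    rw [Finsupp.smul_apply, Finsupp.finsetSum_apply]
    exact_mod_cast this

/-- Clearing denominators in a rational convex combination writes a power of the monomial as a
product of equally many monomials of `I`. -/
theorem monomial_mem_idealClosure {I : Ideal (MvPolynomial (Fin n) 𝕜)} {a : Fin n →₀ ℕ}
    (ha : realVec a ∈ newtonPolyhedron I) :
    MvPolynomial.monomial a (1 : 𝕜) ∈ idealClosure I := by
  have hE : exponents I = realVec '' {a | MvPolynomial.monomial a (1 : 𝕜) ∈ I} := by
    ext v
    exact ⟨fun ⟨a, h, e⟩ => ⟨a, h, e.symm⟩, fun ⟨a, h, e⟩ => ⟨a, h, e.symm⟩⟩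
  rw [newtonPolyhedron, hE] at ha
  obtain ⟨ι, _, e, m, he, hm, hma⟩ := exists_nat_combination ha
  refine isIntegralOverIdeal_of_pow_mem hm ?_
  have h1 : (MvPolynomial.monomial a (1 : 𝕜)) ^ (∑ i, m i) =
      ∏ i, (MvPolynomial.monomial (e i) (1 : 𝕜)) ^ m i := by
    simp only [MvPolynomial.monomial_pow, one_pow]
    rw [hma, MvPolynomial.monomial_sum_one]
  rw [h1, ← Finset.prod_pow_eq_pow_sum]
  exact Ideal.prod_mem_prod fun i _ => Ideal.pow_mem_pow (he i) _

theorem mem_newtonPolyhedron_of_mem_idealClosure {I : Ideal (MvPolynomial (Fin n) 𝕜)}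
    (hI : IsMonomialIdeal I) {f : MvPolynomial (Fin n) 𝕜} (hf : f ∈ idealClosure I)
    {a : Fin n →₀ ℕ} (ha : a ∈ f.support) : realVec a ∈ newtonPolyhedron I := by
  simpa using exists_mem_newtonPolyhedron_of_mem_idealClosure_pow hI one_pos
    (by rwa [pow_one]) ha

theorem isTermwise_idealClosure {I : Ideal (MvPolynomial (Fin n) 𝕜)} (hI : IsMonomialIdeal I) :
    IsTermwise (idealClosure I) := fun _ hf _ ha =>
  monomial_mem_idealClosure (mem_newtonPolyhedron_of_mem_idealClosure hI hf ha)

theorem newtonPolyhedron_idealClosure {I : Ideal (MvPolynomial (Fin n) 𝕜)}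
    (hI : IsMonomialIdeal I) : newtonPolyhedron (idealClosure I) = newtonPolyhedron I := by
  refine (convexHull_min ?_ (convex_newtonPolyhedron I)).antisymm
    (newtonPolyhedron_mono fun x hx => IsIntegralOverIdeal.of_mem hx)
  rintro _ ⟨a, ha, rfl⟩
  exact mem_newtonPolyhedron_of_mem_idealClosure hI ha (a := a) (by simp)

end IntegralClosureNewton

/-! ### Noetherian Rees algebras and stabilization of Newton polyhedra -/

section Noetherian

variable {n : ℕ} {𝕜 : Type*} [Field 𝕜]

/-- The sets `(1 / k) • NP(I_k)` attain their union at `k = c`. -/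
def IsStableAt (F : GradedFamily (MvPolynomial (Fin n) 𝕜)) (c : ℕ) : Prop :=
  0 < c ∧ ∀ k : ℕ, 0 < k → (1 / (k : ℝ)) • newtonPolyhedron (F.ideal k) ⊆
    (1 / (c : ℝ)) • newtonPolyhedron (F.ideal c)

theorem GradedFamily.pow_le {R : Type*} [CommRing R] (F : GradedFamily R) (k m : ℕ) :
    F.ideal k ^ m ≤ F.ideal (m * k) := by
  induction m with
  | zero => simp [F.ideal_zero]
  | succ m ih =>
    rw [pow_succ, Nat.succ_mul]
    exact (Ideal.mul_mono_left ih).trans (F.mul_le _ _)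

theorem smul_newtonPolyhedron_subset_of_dvd (F : GradedFamily (MvPolynomial (Fin n) 𝕜))
    {k c : ℕ} (hk : 0 < k) (hc : 0 < c) (h : k ∣ c) :
    (1 / (k : ℝ)) • newtonPolyhedron (F.ideal k) ⊆
      (1 / (c : ℝ)) • newtonPolyhedron (F.ideal c) := by
  obtain ⟨m, rfl⟩ := h
  intro x hx
  rw [mem_one_div_smul (Nat.cast_pos.mpr hk)] at hx
  rw [mem_one_div_smul (Nat.cast_pos.mpr hc), mul_comm k m, Nat.cast_mul, mul_smul]
  exact newtonPolyhedron_mono (F.pow_le k m)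
    (smul_newtonPolyhedron_subset _ _ (Set.smul_mem_smul_set hx))

theorem monomial_monomial_mem_reesAlgebra {R : Type*} [CommRing R] {J : GradedFamily R} {k : ℕ}
    {r : R} (h : r ∈ J.ideal k) : Polynomial.monomial k r ∈ J.reesAlgebra := by
  intro i
  rw [Polynomial.coeff_monomial]
  split_ifs with hi
  · exact hi ▸ h
  · exact zero_mem _

/-- The ideal spanned by all monomials of positive `t`-degree is generated by finitely many of them.
Comparing the coefficient of one monomial on both sides leaves a generator dividing it, with
quotient still in the Rees algebra: one step of a descent on the degree. -/
theorem exists_finset_of_isNoetherianRing {J : GradedFamily (MvPolynomial (Fin n) 𝕜)}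
    (hJ : ∀ k, IsTermwise (J.ideal k)) (hN : IsNoetherianRing J.reesAlgebra) :
    ∃ T : Finset ((Fin n →₀ ℕ) × ℕ),
      (∀ p ∈ T, 0 < p.2 ∧ MvPolynomial.monomial p.1 (1 : 𝕜) ∈ J.ideal p.2) ∧
      ∀ k, 0 < k → ∀ a : Fin n →₀ ℕ, MvPolynomial.monomial a (1 : 𝕜) ∈ J.ideal k →
        ∃ p ∈ T, p.2 ≤ k ∧ p.1 ≤ a ∧
          MvPolynomial.monomial (a - p.1) (1 : 𝕜) ∈ J.ideal (k - p.2) := by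
  classical
  let X : Set ((Fin n →₀ ℕ) × ℕ) :=
    {p | 0 < p.2 ∧ MvPolynomial.monomial p.1 (1 : 𝕜) ∈ J.ideal p.2}
  let μ : X → J.reesAlgebra := fun p =>
    ⟨Polynomial.monomial p.1.2 (MvPolynomial.monomial p.1.1 (1 : 𝕜)),
      monomial_monomial_mem_reesAlgebra p.2.2⟩
  obtain ⟨s, hs, e⟩ := (Submodule.fg_span_iff_fg_span_finset_subset _).mp
    (IsNoetherian.noetherian (Ideal.span (Set.range μ)))
  rw [← Set.image_univ] at hs
  obtain ⟨T, -, rfl⟩ := Finset.subset_set_image_iff.mp hs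
  refine ⟨T.map (Function.Embedding.subtype _), ?_, fun k hk a ha => ?_⟩
  · intro p hp
    obtain ⟨q, -, rfl⟩ := Finset.mem_map.mp hp
    exact q.2
  have hmem : μ ⟨(a, k), hk, ha⟩ ∈ Submodule.span J.reesAlgebra (μ '' (T : Set X)) := by
    rw [← Finset.coe_image, ← e]
    exact Submodule.subset_span ⟨_, rfl⟩
  obtain ⟨f, hf⟩ := (Submodule.mem_span_image_finset_iff_exists_fun _).mp hmem
  have hf' := congr(MvPolynomial.coeff a (Polynomial.coeff ($hf).1 k))
  rw [AddSubmonoidClass.coe_finsetSum, Polynomial.finsetSum_coeff, MvPolynomial.coeff_sum] at hf'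
  obtain ⟨⟨q, hq⟩, -, hne⟩ := Finset.exists_ne_zero_of_sum_ne_zero (hf'.trans_ne (by simp [μ]))
  refine ⟨q, Finset.mem_map_of_mem _ hq, ?_⟩
  change MvPolynomial.coeff a (((f ⟨q, hq⟩).1 * Polynomial.monomial q.1.2
    (MvPolynomial.monomial q.1.1 (1 : 𝕜))).coeff k) ≠ 0 at hne
  rw [← Polynomial.C_mul_X_pow_eq_monomial, ← mul_assoc, Polynomial.coeff_mul_X_pow'] at hne
  split_ifs at hne with hqk
  · rw [Polynomial.coeff_mul_C, MvPolynomial.coeff_mul_monomial'] at hne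
    split_ifs at hne with hqa
    · rw [mul_one] at hne
      exact ⟨hqk, hqa, hJ _ _ ((f ⟨q, hq⟩).2 _) _ (MvPolynomial.mem_support_iff.mpr hne)⟩
    · exact absurd rfl hne
  · simp at hne

theorem exists_isStableAt_of_isNoetherianRing {J : GradedFamily (MvPolynomial (Fin n) 𝕜)}
    (hJ : ∀ k, IsTermwise (J.ideal k)) (hN : IsNoetherianRing J.reesAlgebra) :
    ∃ c, IsStableAt J c := by
  obtain ⟨T, hT, hgen⟩ := exists_finset_of_isNoetherianRing hJ hN
  let c := ∏ p ∈ T, p.2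
  have hc : 0 < c := Finset.prod_pos fun p hp => (hT p hp).1
  have hc' : (0 : ℝ) < c := Nat.cast_pos.mpr hc
  have hTc : ∀ p ∈ T, (c / p.2 : ℝ) • realVec p.1 ∈ newtonPolyhedron (J.ideal c) := by
    intro p hp
    have hp0 : (0 : ℝ) < p.2 := Nat.cast_pos.mpr (hT p hp).1
    have h := smul_newtonPolyhedron_subset_of_dvd J (hT p hp).1 hc (Finset.dvd_prod_of_mem _ hp)
      (Set.smul_mem_smul_set (realVec_mem_newtonPolyhedron (hT p hp).2))
    rw [mem_one_div_smul hc', smul_smul] at h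
    rwa [mul_one_div] at h
  have key : ∀ k, 0 < k → ∀ a : Fin n →₀ ℕ, MvPolynomial.monomial a (1 : 𝕜) ∈ J.ideal k →
      (c / k : ℝ) • realVec a ∈ newtonPolyhedron (J.ideal c) := by
    intro k
    induction k using Nat.strong_induction_on with
    | _ k ih =>
    intro hk a ha
    have hk0 : (0 : ℝ) < k := Nat.cast_pos.mpr hk
    obtain ⟨⟨b, l⟩, hp, hlk, hba, hmem⟩ := hgen k hk a ha
    dsimp only at hlk hba hmem
    have hl := (hT _ hp).1
    have hb := hTc _ hp
    dsimp only at hl hb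
    have hl0 : (0 : ℝ) < l := Nat.cast_pos.mpr hl
    have hab : realVec a = realVec b + realVec (a - b) := by
      rw [← realVec_add, add_tsub_cancel_of_le hba]
    -- If the quotient has degree 0, upward closure suffices. Otherwise a/k is the mean of b/l and
    -- (a - b)/(k - l) with weights l/k and (k - l)/k.
    rcases hlk.eq_or_lt with rfl | hlk
    · refine newtonPolyhedron_mono_le hb ?_
      rw [hab, smul_add]
      exact le_add_of_nonneg_right (smul_nonneg (by positivity) (realVec_nonneg _))
    · have h := ih (k - l) (by omega) (by omega) _ hmem
      have hkl : (0 : ℝ) < k - l := sub_pos.mpr (Nat.cast_lt.mpr hlk)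
      rw [Nat.cast_sub hlk.le] at h
      have h2 := convex_newtonPolyhedron (J.ideal c) hb h (a := l / k) (b := (k - l) / k)
        (by positivity) (by positivity) (by field_simp; ring)
      rw [smul_smul, smul_smul] at h2
      have e1 : (l / k * (c / l) : ℝ) = c / k := by field_simp
      have e2 : ((k - l) / k * (c / (k - l)) : ℝ) = c / k := by field_simp
      rwa [e1, e2, ← smul_add, ← hab] at h2
  refine ⟨c, hc, fun k hk x hx => ?_⟩
  have hk0 : (0 : ℝ) < k := Nat.cast_pos.mpr hk
  rw [mem_one_div_smul hk0] at hx
  rw [mem_one_div_smul hc']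
  have h := convexHull_min (t := (fun y => (c / k : ℝ) • y) ⁻¹' newtonPolyhedron (J.ideal c))
    (by rintro _ ⟨a, ha, rfl⟩; exact key k hk a ha)
    ((convex_newtonPolyhedron (J.ideal c)).smul_preimage _) hx
  rw [Set.mem_preimage, smul_smul, div_mul_cancel₀ _ hk0.ne'] at h
  exact h

/-- Scale the convex coefficients by k/c and round down. Each generator loses at most `c` in degree,
which bounds `l` independently of `k`; the leftover exponent `b` needs no bound, being absorbed by
the polynomial ring. -/
theorem exists_floor_decomposition {G : Finset (Fin n →₀ ℕ)} {c k : ℕ} (hc : 0 < c)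
    {a : Fin n →₀ ℕ} (h : (c / k : ℝ) • realVec a ∈ newtonPolyhedron (Ideal.span
      ((fun a => MvPolynomial.monomial a (1 : 𝕜)) '' (G : Set (Fin n →₀ ℕ))))) (hk : 0 < k) :
    ∃ (m : (Fin n →₀ ℕ) → ℕ) (l : ℕ) (b : Fin n →₀ ℕ), l ≤ c * G.card ∧
      k = ∑ g ∈ G, m g * c + l ∧ a = ∑ g ∈ G, m g • g + b := by
  have hc0 : (0 : ℝ) < c := Nat.cast_pos.mpr hc
  have hk0 : (0 : ℝ) < k := Nat.cast_pos.mpr hk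
  obtain ⟨l, hl, hl1, hla⟩ := mem_newtonPolyhedron_span_iff.mp h
  let m : (Fin n →₀ ℕ) → ℕ := fun g => ⌊k / c * l g⌋₊
  have hm : ∀ g, (m g : ℝ) ≤ k / c * l g := fun g =>
    Nat.floor_le (mul_nonneg (by positivity) (hl g))
  have hm' : ∀ g, k / c * l g ≤ (m g : ℝ) + 1 := fun g => (Nat.lt_floor_add_one _).le
  have hsum : ∑ g ∈ G, (k / c * l g : ℝ) * c = k := by
    rw [← Finset.sum_mul, ← Finset.mul_sum, hl1]
    field_simp
  have h1 : ∑ g ∈ G, m g * c ≤ k := by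
    have : ((∑ g ∈ G, m g * c : ℕ) : ℝ) ≤ k := by
      push_cast
      rw [← hsum]
      exact Finset.sum_le_sum fun g _ => mul_le_mul_of_nonneg_right (hm g) hc0.le
    exact_mod_cast this
  have h2 : k ≤ ∑ g ∈ G, m g * c + c * G.card := by
    have : (k : ℝ) ≤ ((∑ g ∈ G, m g * c + c * G.card : ℕ) : ℝ) := by
      rw [← hsum]
      push_cast
      refine (Finset.sum_le_sum fun g _ =>
        mul_le_mul_of_nonneg_right (hm' g) hc0.le).trans (le_of_eq ?_)
      simp only [add_mul, Finset.sum_add_distrib, one_mul, Finset.sum_const, nsmul_eq_mul]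
      ring
    exact_mod_cast this
  have h3 : ∑ g ∈ G, m g • g ≤ a := by
    intro i
    have hi := hla i
    rw [Finset.sum_apply] at hi
    simp only [Pi.smul_apply, smul_eq_mul, realVec_apply] at hi
    have : ((∑ g ∈ G, m g * g i : ℕ) : ℝ) ≤ a i := by
      push_cast
      calc ∑ g ∈ G, (m g : ℝ) * g i ≤ ∑ g ∈ G, k / c * l g * g i :=
            Finset.sum_le_sum fun g _ => mul_le_mul_of_nonneg_right (hm g) (Nat.cast_nonneg _)
        _ = k / c * ∑ g ∈ G, l g * g i := by
            rw [Finset.mul_sum]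
            exact Finset.sum_congr rfl fun g _ => by ring
        _ ≤ k / c * (c / k * a i) := mul_le_mul_of_nonneg_left hi (by positivity)
        _ = a i := by field_simp
    rw [Finsupp.finsetSum_apply]
    exact_mod_cast this
  exact ⟨m, k - ∑ g ∈ G, m g * c, a - ∑ g ∈ G, m g • g, by omega, by omega,
    (add_tsub_cancel_of_le h3).symm⟩

/-- A subalgebra that contains a Noetherian subalgebra `A` and is contained in a finitely generated
`A`-module is Noetherian. -/
theorem isNoetherianRing_of_le_span {R S : Type*} [CommRing R] [CommRing S] [Algebra R S]
    {A P : Subalgebra R S} [IsNoetherianRing A] (hAP : A ≤ P) {s : Set S} (hs : s.Finite)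
    (hP : ∀ x ∈ P, x ∈ Submodule.span A s) : IsNoetherianRing P := by
  let _ : Algebra A P := (Subalgebra.inclusion hAP).toAlgebra
  have := isNoetherian_span_of_finite A hs
  let f : P →ₗ[A] Submodule.span A s :=
    { toFun := fun x => ⟨x.1, hP x.1 x.2⟩
      map_add' := fun _ _ => rfl
      map_smul' := fun _ _ => rfl }
  have : IsNoetherian A P := isNoetherian_of_injective f fun x y h =>
    Subtype.ext (congr_arg (fun z : Submodule.span A s => z.1) h)
  exact isNoetherian_of_tower A this

/-- The powers of t that generate the ambient module over R[I t^c] need not lie in the Rees algebra;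
a submodule of a finite module over a Noetherian ring is enough. -/
theorem isNoetherianRing_reesAlgebra {I : Ideal (MvPolynomial (Fin n) 𝕜)}
    (hI : IsMonomialIdeal I) {J : GradedFamily (MvPolynomial (Fin n) 𝕜)}
    (hJ : ∀ k, IsTermwise (J.ideal k)) {c : ℕ} (hc : 0 < c) (hIJ : I ≤ J.ideal c)
    (h : ∀ k, 0 < k → ∀ a : Fin n →₀ ℕ, MvPolynomial.monomial a (1 : 𝕜) ∈ J.ideal k →
      (c / k : ℝ) • realVec a ∈ newtonPolyhedron I) : IsNoetherianRing J.reesAlgebra := by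
  classical
  obtain ⟨G, rfl⟩ := hI.exists_finset
  let μ : (Fin n →₀ ℕ) → Polynomial (MvPolynomial (Fin n) 𝕜) := fun g =>
    Polynomial.monomial c (MvPolynomial.monomial g (1 : 𝕜))
  let A := Algebra.adjoin (MvPolynomial (Fin n) 𝕜) (μ '' (G : Set (Fin n →₀ ℕ)))
  have : IsNoetherianRing A :=
    isNoetherianRing_of_fg ⟨G.image μ, by rw [Finset.coe_image]⟩
  have hμA : ∀ g ∈ G, μ g ∈ A := fun g hg => Algebra.subset_adjoin ⟨g, hg, rfl⟩
  have hAP : A ≤ J.reesAlgebra := by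
    refine Algebra.adjoin_le ?_
    rintro _ ⟨g, hg, rfl⟩
    exact monomial_monomial_mem_reesAlgebra (hIJ (Ideal.subset_span ⟨g, hg, rfl⟩))
  let s : Set (Polynomial (MvPolynomial (Fin n) 𝕜)) :=
    (fun l => Polynomial.X ^ l) '' Set.Iic (c * G.card)
  have key : ∀ k (a : Fin n →₀ ℕ), MvPolynomial.monomial a (1 : 𝕜) ∈ J.ideal k →
      ∃ z ∈ A, ∃ l ≤ c * G.card,
        Polynomial.monomial k (MvPolynomial.monomial a (1 : 𝕜)) = z * Polynomial.X ^ l := by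
    intro k a ha
    rcases Nat.eq_zero_or_pos k with rfl | hk
    · exact ⟨_, A.algebraMap_mem (MvPolynomial.monomial a (1 : 𝕜)), 0, Nat.zero_le _, by
        simp [Polynomial.monomial_zero_left]⟩
    obtain ⟨m, l, b, hl, rfl, rfl⟩ := exists_floor_decomposition hc (h k hk a ha) hk
    refine ⟨algebraMap _ _ (MvPolynomial.monomial b (1 : 𝕜)) * ∏ g ∈ G, μ g ^ m g,
      A.mul_mem (A.algebraMap_mem _)
        (Subalgebra.prod_mem _ fun g hg => Subalgebra.pow_mem _ (hμA g hg) _), l, hl, ?_⟩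
    have e : ∏ g ∈ G, μ g ^ m g = Polynomial.monomial (∑ g ∈ G, m g * c)
        (MvPolynomial.monomial (∑ g ∈ G, m g • g) (1 : 𝕜)) := by
      rw [MvPolynomial.monomial_sum_one, ← Polynomial.C_mul_X_pow_eq_monomial, map_prod,
        ← Finset.prod_pow_eq_pow_sum, ← Finset.prod_mul_distrib]
      refine Finset.prod_congr rfl fun g _ => ?_
      simp only [μ]
      rw [Polynomial.monomial_pow, MvPolynomial.monomial_pow, one_pow,
        Polynomial.C_mul_X_pow_eq_monomial, mul_comm]
    rw [e, Polynomial.algebraMap_apply, Algebra.algebraMap_self, RingHom.id_apply,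
      Polynomial.C_mul_monomial, Polynomial.monomial_mul_X_pow, MvPolynomial.monomial_mul, one_mul,
      add_comm b]
  refine isNoetherianRing_of_le_span hAP (s := s) ((Set.finite_Iic _).image _) fun f hf => ?_
  rw [f.as_sum_support]
  refine Submodule.sum_mem _ fun k _ => ?_
  rw [(f.coeff k).as_sum, map_sum]
  refine Submodule.sum_mem _ fun a ha => ?_
  obtain ⟨z, hz, l, hl, e⟩ := key k a (hJ k _ (hf k) a ha)
  have e2 : Polynomial.monomial k (MvPolynomial.monomial a ((f.coeff k).coeff a)) =
      (⟨algebraMap _ _ (MvPolynomial.C ((f.coeff k).coeff a)) * z,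
        A.mul_mem (A.algebraMap_mem _) hz⟩ : A) • (Polynomial.X ^ l :
          Polynomial (MvPolynomial (Fin n) 𝕜)) := by
    rw [Subalgebra.smul_def, smul_eq_mul, mul_assoc, ← e, Polynomial.algebraMap_apply,
      Algebra.algebraMap_self, RingHom.id_apply, Polynomial.C_mul_monomial,
      MvPolynomial.C_mul_monomial, mul_one]
  rw [e2]
  exact Submodule.smul_mem _ _ (Submodule.subset_span ⟨l, hl, rfl⟩)

end Noetherian

/-! ### Stabilization and the limiting bodies -/

section Bodies

variable {n : ℕ} {𝕜 : Type*} [Field 𝕜] {F : GradedFamily (MvPolynomial (Fin n) 𝕜)}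

theorem IsStableAt.limitingBody_eq {c : ℕ} (h : IsStableAt F c) :
    limitingBody F = (1 / (c : ℝ)) • newtonPolyhedron (F.ideal c) :=
  (Set.iUnion₂_subset h.2).antisymm (Set.subset_iUnion₂_of_subset c h.1 subset_rfl)

theorem exists_isStableAt_of_isPolyhedron (h : IsPolyhedron (limitingBody F)) :
    ∃ c, IsStableAt F c := by
  obtain ⟨m, A, b, hP⟩ := h
  have hmem : ∀ x, x ∈ limitingBody F ↔ ∀ j, A.mulVec x j ≤ b j := fun x => by rw [hP]; rfl
  have hbody : ∀ x, x ∈ limitingBody F ↔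
      ∃ k : ℕ, 0 < k ∧ x ∈ (1 / (k : ℝ)) • newtonPolyhedron (F.ideal k) := fun x => by
    simp [limitingBody]
  have hnonneg : ∀ x, (∀ j, A.mulVec x j ≤ b j) → 0 ≤ x := by
    intro x hx
    obtain ⟨k, -, y, hy, rfl⟩ := (hbody x).mp ((hmem x).mpr hx)
    exact smul_nonneg (by positivity) (newtonPolyhedron_nonneg hy)
  have hV : ∀ v : vertexSet A b, ∃ k : ℕ, 0 < k ∧
      v.1 ∈ (1 / (k : ℝ)) • newtonPolyhedron (F.ideal k) := fun v =>
    (hbody v).mp ((hmem v).mpr v.2.1)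
  choose k hk hv using hV
  have := (finite_vertexSet A b).fintype
  -- A common multiple of indices whose bodies contain the individual vertices.
  let c := ∏ v, k v
  have hc : 0 < c := Finset.prod_pos fun v _ => hk v
  refine ⟨c, hc, fun l hl x hx => ?_⟩
  obtain ⟨y, hy, hyx⟩ :=
    exists_mem_convexHull_vertexSet_le hnonneg ((hmem x).mp ((hbody x).mpr ⟨l, hl, hx⟩))
  have hVc : vertexSet A b ⊆ (1 / (c : ℝ)) • newtonPolyhedron (F.ideal c) := fun v hvV =>
    smul_newtonPolyhedron_subset_of_dvd F (hk ⟨v, hvV⟩) hc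
      (Finset.dvd_prod_of_mem k (Finset.mem_univ _)) (hv ⟨v, hvV⟩)
  have hy' := convexHull_min hVc ((convex_newtonPolyhedron _).smul _) hy
  rw [mem_one_div_smul (Nat.cast_pos.mpr hc)] at hy' ⊢
  exact newtonPolyhedron_mono_le hy' (smul_le_smul_of_nonneg_left hyx (Nat.cast_nonneg _))

/-! ### Convexity of the Newton-Okounkov body -/

theorem mem_iUnion_smul_exponents {x : Fin n → ℝ} :
    x ∈ ⋃ (k : ℕ) (_ : 0 < k), (1 / (k : ℝ)) • exponents (F.ideal k) ↔
      ∃ (k : ℕ) (a : Fin n →₀ ℕ), 0 < k ∧ MvPolynomial.monomial a (1 : 𝕜) ∈ F.ideal k ∧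
        x = (1 / (k : ℝ)) • realVec a := by
  simp only [Set.mem_iUnion]
  constructor
  · rintro ⟨k, hk, _, ⟨a, ha, rfl⟩, rfl⟩
    exact ⟨k, a, hk, ha, rfl⟩
  · rintro ⟨k, a, hk, ha, rfl⟩
    exact ⟨k, hk, Set.smul_mem_smul_set (realVec_mem_exponents ha)⟩

theorem GradedFamily.monomial_nsmul_mem {k : ℕ} {a : Fin n →₀ ℕ}
    (h : MvPolynomial.monomial a (1 : 𝕜) ∈ F.ideal k) (m : ℕ) :
    MvPolynomial.monomial (m • a) (1 : 𝕜) ∈ F.ideal (m * k) := by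
  have := F.pow_le k m (Ideal.pow_mem_pow h m)
  rwa [MvPolynomial.monomial_pow, one_pow] at this

variable (F) in
theorem smul_exponents_subset_newtonOkounkovBody {k : ℕ} (hk : 0 < k) :
    (1 / (k : ℝ)) • exponents (F.ideal k) ⊆ newtonOkounkovBody F :=
  (Set.subset_iUnion₂ (s := fun (k : ℕ) (_ : 0 < k) => (1 / (k : ℝ)) • exponents (F.ideal k))
    k hk).trans subset_closure

variable (F) in
theorem convex_newtonOkounkovBody : Convex ℝ (newtonOkounkovBody F) := by
  set S := ⋃ (k : ℕ) (_ : 0 < k), (1 / (k : ℝ)) • exponents (F.ideal k)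
  have hrat : ∀ x ∈ S, ∀ y ∈ S, ∀ p q : ℕ, 0 < p + q →
      ((p : ℝ) / (p + q : ℕ)) • x + ((q : ℝ) / (p + q : ℕ)) • y ∈ S := by
    intro x hx y hy p q hpq
    obtain ⟨k, a, hk, ha, rfl⟩ := mem_iUnion_smul_exponents.mp hx
    obtain ⟨l, b, hl, hb, rfl⟩ := mem_iUnion_smul_exponents.mp hy
    -- The factors `l` and `k` bring a/k and b/l to the common denominator `k * l`; the total degree
    -- is `(p + q) * (k * l)`.
    refine mem_iUnion_smul_exponents.mpr ⟨(p * l) * k + (q * k) * l, (p * l) • a + (q * k) • b,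
      ?_, ?_, ?_⟩
    · have : (p * l) * k + (q * k) * l = (p + q) * (k * l) := by ring
      rw [this]
      positivity
    · have := F.mul_le _ _ (Ideal.mul_mem_mul (F.monomial_nsmul_mem ha (p * l))
        (F.monomial_nsmul_mem hb (q * k)))
      rwa [MvPolynomial.monomial_mul, one_mul] at this
    · have hk0 : (k : ℝ) ≠ 0 := by positivity
      have hl0 : (l : ℝ) ≠ 0 := by positivity
      have hpq0 : (p + q : ℝ) ≠ 0 := by exact_mod_cast hpq.ne'
      have e : (p * l * k + q * k * l : ℝ) = (p + q) * (k * l) := by ring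
      ext i
      simp only [realVec_add, realVec_nsmul, Pi.add_apply, Pi.smul_apply, smul_eq_mul]
      push_cast
      rw [e]
      field_simp
  have hseg : ∀ x ∈ S, ∀ y ∈ S, ∀ s t : ℝ, 0 ≤ s → 0 ≤ t → s + t = 1 →
      s • x + t • y ∈ _root_.closure S := by
    intro x hx y hy s t hs ht hst
    have hs1 : s ≤ 1 := by linarith
    -- Real weights are limits of rational ones, for which `hrat` applies.
    have hlim : Filter.Tendsto (fun m : ℕ => (⌊s * m⌋₊ : ℝ) / m) Filter.atTop (nhds s) :=
      (tendsto_nat_floor_mul_div_atTop hs).comp tendsto_natCast_atTop_atTop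
    have hlim2 : Filter.Tendsto (fun m : ℕ => ((⌊s * m⌋₊ : ℝ) / m) • x +
        (1 - (⌊s * m⌋₊ : ℝ) / m) • y) Filter.atTop (nhds (s • x + (1 - s) • y)) :=
      (hlim.smul_const x).add ((tendsto_const_nhds.sub hlim).smul_const y)
    rw [← hst, add_sub_cancel_left] at hlim2
    refine mem_closure_of_tendsto hlim2 ?_
    filter_upwards [Filter.eventually_gt_atTop 0] with m hm
    have hm0 : (0 : ℝ) < m := Nat.cast_pos.mpr hm
    have hle : ⌊s * m⌋₊ ≤ m := by
      rw [← Nat.floor_natCast (R := ℝ) m]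
      refine Nat.floor_le_floor ?_
      rw [Nat.floor_natCast]
      nlinarith
    have h := hrat x hx y hy ⌊s * m⌋₊ (m - ⌊s * m⌋₊) (by omega)
    rw [Nat.add_sub_cancel' hle, Nat.cast_sub hle, sub_div, div_self hm0.ne'] at h
    rwa [hst]
  intro x hx y hy s t hs ht hst
  have h := map_mem_closure₂ (f := fun x y : Fin n → ℝ => s • x + t • y) (s := S) (t := S)
    (u := _root_.closure S) (by fun_prop) hx hy fun x hx y hy => hseg x hx y hy s t hs ht hst
  rwa [closure_closure] at h

theorem IsStableAt.newtonOkounkovBody_eq {c : ℕ} (h : IsStableAt F c)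
    (hF : IsMonomialIdeal (F.ideal c)) :
    newtonOkounkovBody F = (1 / (c : ℝ)) • newtonPolyhedron (F.ideal c) := by
  have hc : (0 : ℝ) < c := Nat.cast_pos.mpr h.1
  refine (closure_minimal (Set.iUnion₂_subset fun k hk => ?_)
    (hF.isPolyhedron_newtonPolyhedron.smul hc).isClosed).antisymm ?_
  · exact (Set.smul_set_mono (subset_convexHull _ _)).trans (h.2 k hk)
  · rw [newtonPolyhedron, ← convexHull_smul]
    exact convexHull_min (smul_exponents_subset_newtonOkounkovBody F h.1)
      (convex_newtonOkounkovBody F)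

theorem isStableAt_of_newtonOkounkovBody_eq {c : ℕ} (hc : 0 < c)
    (h : newtonOkounkovBody F = (1 / (c : ℝ)) • newtonPolyhedron (F.ideal c)) :
    IsStableAt F c := by
  refine ⟨hc, fun k hk => ?_⟩
  rw [← h, newtonPolyhedron, ← convexHull_smul]
  exact convexHull_min (smul_exponents_subset_newtonOkounkovBody F hk)
    (convex_newtonOkounkovBody F)

/-! ### Stability in terms of multiples of c, integral closures and Rees algebras -/

theorem isStableAt_iff_forall_eq {c : ℕ} (hc : 0 < c) :
    IsStableAt F c ↔ ∀ k : ℕ, 0 < k → (1 / (c : ℝ)) • newtonPolyhedron (F.ideal c) =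
      (1 / ((k : ℝ) * (c : ℝ))) • newtonPolyhedron (F.ideal (k * c)) := by
  simp only [← Nat.cast_mul]
  refine ⟨fun h k hk => (smul_newtonPolyhedron_subset_of_dvd F hc (by positivity)
    (Dvd.intro_left k rfl)).antisymm (h.2 _ (by positivity)), fun h => ⟨hc, fun k hk => ?_⟩⟩
  rw [h k hk]
  exact smul_newtonPolyhedron_subset_of_dvd F hk (by positivity) (Dvd.intro c rfl)

/-- Forward, lattice points of NP(I_{kc}) lie in k NP(I_c) ⊆ NP(I_c^k). Backward, the valuation
argument divides exponents integral over I_c^k by k and lands in NP(I_c). -/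
theorem isStableAt_iff_idealClosure_eq (hF : ∀ k, IsMonomialIdeal (F.ideal k)) {c : ℕ}
    (hc : 0 < c) : IsStableAt F c ↔
      ∀ k : ℕ, idealClosure (F.ideal c ^ k) = idealClosure (F.ideal (k * c)) := by
  have hc0 : (0 : ℝ) < c := Nat.cast_pos.mpr hc
  constructor
  · intro h k
    rcases Nat.eq_zero_or_pos k with rfl | hk
    · simp [F.ideal_zero]
    have hk0 : (0 : ℝ) < k := Nat.cast_pos.mpr hk
    refine le_antisymm (fun x hx => hx.mono (F.pow_le c k)) fun f hf =>
      mem_of_monomials_mem fun a ha => monomial_mem_idealClosure ?_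
    have h1 := mem_newtonPolyhedron_of_mem_idealClosure (hF _) hf ha
    have h2 := h.2 (k * c) (by positivity) (Set.smul_mem_smul_set h1)
    rw [mem_one_div_smul hc0, smul_smul] at h2
    refine smul_newtonPolyhedron_subset _ _ ⟨_, h2, ?_⟩
    dsimp only
    rw [smul_smul]
    have : (k * (c * (1 / (k * c : ℕ))) : ℝ) = 1 := by
      push_cast
      field_simp
    rw [this, one_smul]
  · refine fun h => ⟨hc, fun k hk => ?_⟩
    have hk0 : (0 : ℝ) < k := Nat.cast_pos.mpr hk
    refine (smul_newtonPolyhedron_subset_of_dvd F hk (c := k * c) (by positivity)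
      (Dvd.intro c rfl)).trans fun x hx => ?_
    rw [mem_one_div_smul (by positivity), Nat.cast_mul] at hx
    rw [mem_one_div_smul hc0]
    have h1 : newtonPolyhedron (F.ideal (k * c)) ⊆
        (fun y => (k : ℝ)⁻¹ • y) ⁻¹' newtonPolyhedron (F.ideal c) := by
      refine convexHull_min ?_ ((convex_newtonPolyhedron _).smul_preimage _)
      rintro _ ⟨a, ha, rfl⟩
      refine exists_mem_newtonPolyhedron_of_mem_idealClosure_pow (hF c) hk (a := a)
        (f := MvPolynomial.monomial a (1 : 𝕜)) ?_ (by simp)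
      rw [h k]
      exact IsIntegralOverIdeal.of_mem ha
    have h2 := h1 hx
    rwa [Set.mem_preimage, smul_smul, inv_mul_cancel_left₀ hk0.ne'] at h2

theorem isStableAt_closure_iff (hF : ∀ k, IsMonomialIdeal (F.ideal k)) {c : ℕ} :
    IsStableAt F.closure c ↔ IsStableAt F c := by
  have h : ∀ k, newtonPolyhedron (F.closure.ideal k) = newtonPolyhedron (F.ideal k) := fun k =>
    newtonPolyhedron_idealClosure (hF k)
  simp only [IsStableAt, h]

/-- The second family `J` allows both `F` and `F.closure` to be treated at once. -/
theorem IsStableAt.isNoetherianRing {c : ℕ} (hF : ∀ k, IsMonomialIdeal (F.ideal k))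
    (h : IsStableAt F c) {J : GradedFamily (MvPolynomial (Fin n) 𝕜)}
    (hJ : ∀ k, IsTermwise (J.ideal k)) (hFJ : F.ideal c ≤ J.ideal c)
    (hJF : ∀ k, newtonPolyhedron (J.ideal k) ⊆ newtonPolyhedron (F.ideal k)) :
    IsNoetherianRing J.reesAlgebra := by
  refine isNoetherianRing_reesAlgebra (hF c) hJ h.1 hFJ fun k hk a ha => ?_
  have h1 := h.2 k hk (Set.smul_mem_smul_set (hJF k (realVec_mem_newtonPolyhedron ha)))
  rwa [mem_one_div_smul (Nat.cast_pos.mpr h.1), smul_smul, mul_one_div] at h1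

end Bodies

end MonomialFamily

theorem theorem3p3 {𝕜 : Type*} [Field 𝕜] (n : ℕ)
    (F : MonomialFamily.GradedFamily (MvPolynomial (Fin n) 𝕜))
    (hF : ∀ k, MonomialFamily.IsMonomialIdeal (F.ideal k)) :
    List.TFAE [
      MonomialFamily.IsPolyhedron (MonomialFamily.limitingBody F),
      ∃ c : ℕ, 0 < c ∧ MonomialFamily.newtonOkounkovBody F =
        (1 / (c : ℝ)) • MonomialFamily.newtonPolyhedron (F.ideal c),
      ∃ c : ℕ, 0 < c ∧ ∀ k : ℕ, 0 < k →
        (1 / (c : ℝ)) • MonomialFamily.newtonPolyhedron (F.ideal c) =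
          (1 / ((k : ℝ) * (c : ℝ))) • MonomialFamily.newtonPolyhedron (F.ideal (k * c)),
      ∃ c : ℕ, 0 < c ∧ ∀ k : ℕ,
        MonomialFamily.idealClosure (F.ideal c ^ k) =
          MonomialFamily.idealClosure (F.ideal (k * c)),
      IsNoetherianRing F.closure.reesAlgebra,
      IsNoetherianRing F.reesAlgebra] := by
  open MonomialFamily in
  have hcl : ∀ k, IsTermwise (F.closure.ideal k) := fun k => isTermwise_idealClosure (hF k)
  tfae_have 1 → 2 := fun h => by
    obtain ⟨c, hc⟩ := exists_isStableAt_of_isPolyhedron h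
    exact ⟨c, hc.1, hc.newtonOkounkovBody_eq (hF c)⟩
  tfae_have 2 → 3 := fun ⟨c, hc, h⟩ =>
    ⟨c, hc, (isStableAt_iff_forall_eq hc).mp (isStableAt_of_newtonOkounkovBody_eq hc h)⟩
  tfae_have 3 → 4 := fun ⟨c, hc, h⟩ =>
    ⟨c, hc, (isStableAt_iff_idealClosure_eq hF hc).mp ((isStableAt_iff_forall_eq hc).mpr h)⟩
  tfae_have 4 → 5 := fun ⟨c, hc, h⟩ =>
    ((isStableAt_iff_idealClosure_eq hF hc).mpr h).isNoetherianRing hF hcl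
      (fun _ hx => IsIntegralOverIdeal.of_mem hx)
      fun k => (newtonPolyhedron_idealClosure (hF k)).subset
  tfae_have 5 → 6 := fun h => by
    obtain ⟨c, hc⟩ := exists_isStableAt_of_isNoetherianRing hcl h
    exact ((isStableAt_closure_iff hF).mp hc).isNoetherianRing hF (fun k => (hF k).isTermwise)
      le_rfl fun _ => subset_rfl
  tfae_have 6 → 1 := fun h => by
    obtain ⟨c, hc⟩ := exists_isStableAt_of_isNoetherianRing (fun k => (hF k).isTermwise) h
    rw [hc.limitingBody_eq]
    exact (hF c).isPolyhedron_newtonPolyhedron.smul (Nat.cast_pos.mpr hc.1)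
  tfae_finish
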